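/- Let $\mathbb D$ be the open unit disk, $\alpha\in\mathbb C$ with $\operatorname{Re}\alpha>0$, $\beta<1$ real, $\lambda\in\mathbb D$ and $z_0\in\mathbb D\setminus\{0\}$. Let $\mathcal A$ be the set of functions $f$ analytic in $\mathbb D$ with $f(0)=0=f'(0)-1$, let $\mathcal F(\alpha,\beta)$ be the set of $f\in\mathcal A$ with $f'(z)+\alpha zf''(z)\prec\frac{1+(1-2\beta)z}{1-z}$ in $\mathbb D$ (where $g\prec h$ means $g=h\circ\omega$ for some analytic $\omega:\mathbb D\to\mathbb D$ with $\omega(0)=0$), and put $$\mathcal G(\lambda)=\Big\{f\in\mathcal F(\alpha,\beta):f''(0)=\tfrac{2(1-\beta)}{1+\alpha}\lambda\Big\},\qquad V_{\mathcal G}(z_0,\lambda)=\{(1-\alpha)f(z_0)+\alpha z_0f'(z_0):f\in\mathcal G(\lambda)\}.$$ Let $\delta(z,\lambda)=\frac{z+\lambda}{1+\overline\lambda z}$. For every $\theta\in\mathbb R$ there is exactly one $F_{e^{i\theta},\lambda}\in\mathcal A$ with $$(1-\alpha)F_{e^{i\theta},\lambda}(z)+\alpha zF_{e^{i\theta},\lambda}'(z)=\int_0^z\frac{1+(1-2\beta)\,\delta(e^{i\theta}\zeta,\lambda)\,\zeta}{1-\delta(e^{i\theta}\zeta,\lambda)\,\zeta}\,d\zeta\qquad(z\in\mathbb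 D),$$ and $F_{e^{i\theta},\lambda}\in\mathcal G(\lambda)$. The boundary $\partial V_{\mathcal G}(z_0,\lambda)$ is the Jordan curve given by $$(-\pi,\pi]\ni\theta\mapsto(1-\alpha)F_{e^{i\theta},\lambda}(z_0)+\alpha z_0F_{e^{i\theta},\lambda}'(z_0)=(2\beta-1)z_0+\frac{(1-\beta)e^{-i\theta/2}}{\sqrt{1-b^2}}\Big[\big(1+\overline\lambda e^{i\theta/2}(-\sqrt{1-b^2}+ib)\big)\log\Big(1+\frac{e^{i\theta/2}z_0}{\sqrt{1-b^2}-ib}\Big)-\big(1+\overline\lambda e^{i\theta/2}(\sqrt{1-b^2}+ib)\big)\log\Big(1-\frac{e^{i\theta/2}z_0}{\sqrt{1-b^2}+ib}\Big)\Big],$$ where $b=\operatorname{Im}(\overline\lambda e^{i\theta/2})$ and $\log$ is the principal branch. That is, this map is injective on $(-\pi,\pi]$, extends to a continuous closed curve on $[-\pi,\pi]$, and its image is $\partial V_{\mathcal G}(z_0,\lambda)$. Moreover, if $(1-\alpha)f(z_0)+\alpha z_0f'(z_0)=(1-\alpha)F_{e^{i\theta},\lambda}(z_0)+\alpha z_0F_{e^{i\theta},\lambda}'(z_0)$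 for some $f\in\mathcal G(\lambda)$ and $\theta\in(-\pi,\pi]$, then $f=F_{e^{i\theta},\lambda}$ in $\mathbb D$. -/

import Mathlib

open Set Metric

noncomputable section

/-- `f` represents an element of the class `𝒜`: it is analytic in the open unit disk and
`f 0 = f' 0 - 1 = 0`. Only the values of `f` in the unit disk matter. -/
def NormalizedAnalytic (f : ℂ → ℂ) : Prop :=
  DifferentiableOn ℂ f (ball 0 1) ∧ f 0 = 0 ∧ deriv f 0 = 1

/-- Subordination `g ≺ h` in the unit disk: `g = h ∘ ω` in the disk for some analytic self-map `ω`
of the unit disk with `ω 0 = 0`. -/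
def Subordinate (g h : ℂ → ℂ) : Prop :=
  ∃ ω : ℂ → ℂ, DifferentiableOn ℂ ω (ball 0 1) ∧ MapsTo ω (ball 0 1) (ball 0 1) ∧ ω 0 = 0 ∧
    ∀ z ∈ ball (0 : ℂ) 1, g z = h (ω z)

/-- The class `ℱ(α, β)`: normalized analytic `f` with
`f'(z) + α z f''(z) ≺ (1 + (1 - 2β) z) / (1 - z)` in the unit disk. -/
def ClassF (α : ℂ) (β : ℝ) : Set (ℂ → ℂ) :=
  {f | NormalizedAnalytic f ∧
    Subordinate (fun z => deriv f z + α * z * deriv (deriv f) z)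
      (fun z => (1 + (1 - 2 * (β : ℂ)) * z) / (1 - z))}

/-- The class `𝒢(λ)`: those `f ∈ ℱ(α, β)` with `f''(0) = 2 (1 - β) / (1 + α) λ`. -/
def ClassG (α : ℂ) (β : ℝ) (lam : ℂ) : Set (ℂ → ℂ) :=
  {f | f ∈ ClassF α β ∧ deriv (deriv f) 0 = 2 * ((1 - (β : ℂ)) / (1 + α)) * lam}

/-- The functional `(1 - α) f(z) + α z f'(z)`. -/
def valueG (α z : ℂ) (f : ℂ → ℂ) : ℂ :=
  (1 - α) * f z + α * z * deriv f z

/-- The region of variability `V_𝒢(z₀, λ) = {(1 - α) f(z₀) + α z₀ f'(z₀) : f ∈ 𝒢(λ)}`. -/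
def regionG (α : ℂ) (β : ℝ) (z₀ lam : ℂ) : Set ℂ :=
  valueG α z₀ '' ClassG α β lam

/-- `δ(z, λ) = (z + λ) / (1 + conj λ * z)`. -/
def mobiusDelta (z lam : ℂ) : ℂ :=
  (z + lam) / (1 + (starRingEnd ℂ) lam * z)

/-- The function `ζ ↦ (1 + (1 - 2β) δ(aζ, λ) ζ) / (1 - δ(aζ, λ) ζ)`. -/
def extremalP (β : ℝ) (lam a ζ : ℂ) : ℂ :=
  (1 + (1 - 2 * (β : ℂ)) * mobiusDelta (a * ζ) lam * ζ) / (1 - mobiusDelta (a * ζ) lam * ζ)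

/-- `F` is the extremal function `F_{a,λ}`: the normalized analytic function with
`(1 - α) F(z) + α z F'(z) = ∫₀ᶻ (1 + (1 - 2β) δ(aζ, λ) ζ) / (1 - δ(aζ, λ) ζ) dζ` in the unit disk.
The integrand is analytic in the disk, and the integral is taken along the segment from `0`
to `z`. -/
def IsExtremalFunction (α : ℂ) (β : ℝ) (lam a : ℂ) (F : ℂ → ℂ) : Prop :=
  NormalizedAnalytic F ∧
    ∀ z ∈ ball (0 : ℂ) 1, valueG α z F = ∫ t in (0 : ℝ)..1, extremalP β lam a (t * z) * z

/-- `θ ↦ γ θ`, `-π < θ ≤ π`, is a parametrization of a Jordan curve (a simple closed curve). -/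
def IsJordanParametrization (γ : ℝ → ℂ) : Prop :=
  ContinuousOn γ (Icc (-Real.pi) Real.pi) ∧ γ (-Real.pi) = γ Real.pi ∧
    InjOn γ (Ioc (-Real.pi) Real.pi)

/-- The closed form of the boundary curve, with `b = Im (conj λ * exp (iθ/2))` and principal
logarithms. -/
def boundaryCurve (β : ℝ) (lam z₀ : ℂ) (θ : ℝ) : ℂ :=
  let e : ℂ := Complex.exp (Complex.I * θ / 2)
  let b : ℝ := ((starRingEnd ℂ) lam * e).im
  let s : ℝ := Real.sqrt (1 - b ^ 2)
  (2 * (β : ℂ) - 1) * z₀ +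
    (1 - (β : ℂ)) * Complex.exp (-(Complex.I * θ / 2)) / s *
      ((1 + (starRingEnd ℂ) lam * e * (-(s : ℂ) + Complex.I * b)) *
          Complex.log (1 + e * z₀ / (s - Complex.I * b)) -
        (1 + (starRingEnd ℂ) lam * e * (s + Complex.I * b)) *
          Complex.log (1 - e * z₀ / (s + Complex.I * b)))

end

/-!
For `f ∈ 𝒢(λ)` the function `z ↦ valueG α z f` has derivative `f' + α z f''`, and applying the
Schwarz lemma twice to the subordinating function writes this derivative as
`extremalP β λ (χ z) z` with `χ` holomorphic and `‖χ‖ ≤ 1` (`exists_parameter_of_mem_classG`). The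
extremal functions are those with `χ` a unimodular constant `a`. They exist and are unique because
`c Y + z Y' = G` has exactly one holomorphic solution in the disk when `0 < Re c`
(`euler_ode_exists`, `euler_ode_unique`).

*Each extremal value is an exposed boundary point* (`exists_supporting_direction`). For fixed `z` the
values `extremalP β λ x z`, `‖x‖ ≤ 1`, fill a disk, tangent at `x = a` to a line whose normal has the
direction of `a z² / D(z)²`, where `D = mobiusDenom λ a`. So if `X` is the difference of the two
functions `valueG α · f` and `valueG α · F_a`, then `conj a X' / (z² / D²)` has nonpositive real
part. The primitive of `z² / D²` is starlike, in that the logarithmic derivative of the primitive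
has positive real part after multiplication by `z` (`exists_starlike_primitive`); a differential
subordination argument, which looks at a boundary maximum of the real part, then gives the same
inequality for the quotient `W` of the primitives (`re_nonpos_of_differential_subordination`). At
`z₀` this is a supporting half-plane. Equality of the values makes `W` vanish at `z₀`, so `W = 0` by
the maximum principle, and then `f = F_a`.

*There are no other boundary points* (`frontier_eq_image_sphere`). The extremal value
`Γ(a) = extremalValue β λ z₀ a` makes sense and lies in the region for all `‖a‖ ≤ 1`, and `Γ` is
holomorphic. Since `Γ` maps the open disk onto an open set and the circle into the boundary of the
convex region, the image of the open disk is open and closed in the interior of the region, hence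
equal to it, and the boundary is the image of the circle. Neither compactness of the class nor the
Jordan curve theorem is needed.

The closed form is checked by differentiation in `z₀`, using the factorization of `D`
(`hasDerivAt_boundaryCurve`).
-/

/-! ### Calculus in the unit disk -/

theorem hasDerivAt_of_differentiableOn_unitDisk {f : ℂ → ℂ} (hf : DifferentiableOn ℂ f (ball 0 1))
    {z : ℂ} (hz : z ∈ ball (0 : ℂ) 1) : HasDerivAt f (deriv f z) z :=
  (hf.differentiableAt (isOpen_ball.mem_nhds hz)).hasDerivAt

theorem real_mul_mem_unitDisk {z : ℂ} (hz : z ∈ ball (0 : ℂ) 1) {t : ℝ} (ht : t ∈ Icc (0 : ℝ) 1) :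
    (t : ℂ) * z ∈ ball (0 : ℂ) 1 := by
  rw [mem_ball_zero_iff] at hz ⊢
  rw [norm_mul, Complex.norm_real, Real.norm_of_nonneg ht.1]
  exact lt_of_le_of_lt (mul_le_of_le_one_left (norm_nonneg _) ht.2) hz

/-! ### The Euler equation `c Y + z Y' = G` in the unit disk -/

/-- Coefficientwise, `y_n = g_n / (c + n)`. Since `0 < Re c`, the factors `1 / (c + n)` are bounded,
so the new series converges wherever the Taylor series of `G` does. -/
theorem euler_ode_exists {c : ℂ} (hc : 0 < c.re) {G : ℂ → ℂ} (hG : DifferentiableOn ℂ G (ball 0 1)) :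
    ∃ Y : ℂ → ℂ, DifferentiableOn ℂ Y (ball 0 1) ∧
      ∀ z ∈ ball (0 : ℂ) 1, c * Y z + z * deriv Y z = G z := by
  set g : ℕ → ℂ := fun n => (n.factorial : ℂ)⁻¹ * iteratedDeriv n G 0 with hg
  have hsum : ∀ z ∈ ball (0 : ℂ) 1, HasSum (fun n => g n * z ^ n) (G z) := by
    intro z hz
    refine (Complex.hasSum_taylorSeries_on_ball hG hz).congr_fun fun n => ?_
    simp [hg]; ring
  have hcn : ∀ n : ℕ, c + n ≠ 0 := by
    intro n h
    have := congrArg Complex.re h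
    simp at this
    have : (0 : ℝ) ≤ n := n.cast_nonneg
    linarith
  have hcb : ∀ n : ℕ, ‖(c + n)⁻¹‖ ≤ c.re⁻¹ := by
    intro n
    rw [norm_inv]
    apply inv_anti₀ hc
    refine le_trans ?_ (Complex.re_le_norm _)
    simp
  set Y : ℂ → ℂ := fun z => ∑' n, g n / (c + n) * z ^ n with hY
  -- Everything is checked on a smaller disk of radius `r < 1`, where the majorant is summable.
  have key : ∀ z ∈ ball (0 : ℂ) 1, ∃ r : ℝ, z ∈ ball (0 : ℂ) r ∧
      ∃ u : ℕ → ℝ, Summable u ∧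
        ∀ (n : ℕ) (w : ℂ), w ∈ ball (0 : ℂ) r → ‖g n / (c + n) * w ^ n‖ ≤ u n := by
    intro z hz
    obtain ⟨r, hr1, hr2⟩ := exists_between (mem_ball_zero_iff.1 hz)
    have hr0 : 0 < r := lt_of_le_of_lt (norm_nonneg _) hr1
    refine ⟨r, mem_ball_zero_iff.2 hr1, fun n => c.re⁻¹ * ‖g n * (r : ℂ) ^ n‖, ?_, ?_⟩
    · have : (r : ℂ) ∈ ball (0 : ℂ) 1 := by
        rw [mem_ball_zero_iff, Complex.norm_real, Real.norm_of_nonneg hr0.le]; exact hr2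
      exact (hsum _ this).summable.norm.mul_left _
    · intro n w hw
      rw [mem_ball_zero_iff] at hw
      have h0 : ‖g n * (r : ℂ) ^ n‖ = ‖g n‖ * r ^ n := by
        rw [norm_mul, norm_pow, Complex.norm_real, Real.norm_of_nonneg hr0.le]
      have h2 : ‖g n / (c + n) * w ^ n‖ = ‖g n‖ * ‖(c + n)⁻¹‖ * ‖w‖ ^ n := by
        rw [div_eq_mul_inv, norm_mul, norm_mul, norm_pow]
      rw [h2]
      simp only [h0]
      have h1 : ‖w‖ ^ n ≤ r ^ n := pow_le_pow_left₀ (norm_nonneg _) hw.le n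
      calc ‖g n‖ * ‖(c + n)⁻¹‖ * ‖w‖ ^ n ≤ ‖g n‖ * c.re⁻¹ * r ^ n := by
            gcongr; exact hcb n
        _ = _ := by ring
  have hd : ∀ n : ℕ, Differentiable ℂ (fun z : ℂ => g n / (c + n) * z ^ n) := by
    intro n; fun_prop
  refine ⟨Y, ?_, ?_⟩
  · intro z hz
    obtain ⟨r, hzr, u, hu, hle⟩ := key z hz
    have := Complex.differentiableOn_tsum_of_summable_norm hu
      (fun n => (hd n).differentiableOn) isOpen_ball hle
    exact (this.differentiableAt (isOpen_ball.mem_nhds hzr)).differentiableWithinAt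
  · intro z hz
    obtain ⟨r, hzr, u, hu, hle⟩ := key z hz
    have h1 := Complex.hasSum_deriv_of_summable_norm hu
      (fun n => (hd n).differentiableOn) isOpen_ball hle hzr
    have h2 : HasSum (fun n => g n / (c + n) * z ^ n) (Y z) :=
      (Summable.of_norm_bounded hu fun n => hle n z hzr).hasSum
    have h3 := (h2.mul_left c).add (h1.mul_left z)
    refine h3.unique ((hsum z hz).congr_fun fun n => ?_)
    have h4 : deriv (fun z : ℂ => g n / (c + n) * z ^ n) z = g n / (c + n) * (n * z ^ (n - 1)) := by
      simp
    rw [h4]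
    rcases n with _ | n
    · have := hcn 0
      simp at this ⊢
      field_simp
    · have := hcn (n + 1)
      simp only [Nat.add_sub_cancel]
      field_simp
      ring

/-- Along each ray, `t ^ c Y (t z)` is constant for `t > 0` and tends to `0` as `t → 0`. -/
theorem euler_ode_unique {c : ℂ} (hc : 0 < c.re) {Y : ℂ → ℂ} (hY : DifferentiableOn ℂ Y (ball 0 1))
    (h : ∀ z ∈ ball (0 : ℂ) 1, c * Y z + z * deriv Y z = 0) : ∀ z ∈ ball (0 : ℂ) 1, Y z = 0 := by
  intro z hz
  have hmem := fun t ht => @real_mul_mem_unitDisk z hz t ht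
  set k : ℝ → ℂ := fun t => (t : ℂ) ^ c * Y (t * z) with hk
  have hc0 : c ≠ 0 := fun h0 => by simp [h0] at hc
  have hder : ∀ t ∈ Ioo (0 : ℝ) 1, HasDerivAt k 0 t := by
    intro t ht
    have hzt := hmem t ⟨ht.1.le, ht.2.le⟩
    have h1 : HasDerivAt (fun t : ℝ => (t : ℂ) ^ c) (c * (t : ℂ) ^ (c - 1)) t := by
      have := (hasDerivAt_id (t : ℂ)).cpow_const (c := c) (Or.inl (by simpa using ht.1))
      simpa using this.comp_ofReal
    have h2 : HasDerivAt (fun t : ℝ => Y (t * z)) (deriv Y (t * z) * z) t := by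
      have h3 : HasDerivAt (fun s : ℂ => Y (s * z)) (deriv Y (t * z) * z) (t : ℂ) := by
        have := (hasDerivAt_of_differentiableOn_unitDisk hY hzt).comp (t : ℂ)
          ((hasDerivAt_id (t : ℂ)).mul_const z)
        simpa [Function.comp_def] using this
      exact h3.comp_ofReal
    have h4 := h1.mul h2
    refine h4.congr_deriv ?_
    have ht0 : (t : ℂ) ≠ 0 := by exact_mod_cast ht.1.ne'
    have : (t : ℂ) ^ c = (t : ℂ) ^ (c - 1) * t := by
      rw [Complex.cpow_sub _ _ ht0, Complex.cpow_one]; field_simp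
    rw [this]
    linear_combination (t : ℂ) ^ (c - 1) * h _ hzt
  have hcont : ContinuousOn k (Icc 0 1) := by
    apply ContinuousOn.mul
    · intro t _
      exact (Complex.continuousAt_ofReal_cpow_const t c (Or.inl hc)).continuousWithinAt
    · exact hY.continuousOn.comp (by fun_prop) (fun t ht => hmem t ht)
  have hconst : k 1 = k 0 := by
    have := intervalIntegral.integral_eq_sub_of_hasDerivAt_of_le zero_le_one hcont hder
      intervalIntegrable_const
    rw [intervalIntegral.integral_zero] at this
    exact sub_eq_zero.1 this.symm
  have h0 : k 0 = 0 := by simp [hk, Complex.zero_cpow hc0]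
  rw [h0] at hconst
  simpa [hk] using hconst

/-! ### A boundary maximum principle for the real part -/

/-- Where `Re W` is maximal over a closed disk about `0`, at a boundary point `z`, the derivative of
`W` in the direction `i z` is purely imaginary and the one in the direction `z` has nonnegative real
part: `z W' z` is real and nonnegative. -/
theorem exists_max_re_on_closedBall {W : ℂ → ℂ} (hW : DifferentiableOn ℂ W (ball 0 1)) {r : ℝ}
    (hr0 : 0 < r) (hr1 : r < 1) :
    ∃ z : ℂ, ‖z‖ = r ∧ (∀ w : ℂ, ‖w‖ ≤ r → (W w).re ≤ (W z).re) ∧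
      (z * deriv W z).im = 0 ∧ 0 ≤ (z * deriv W z).re := by
  have hsub : closedBall (0 : ℂ) r ⊆ ball 0 1 := closedBall_subset_ball hr1
  have hE : DiffContOnCl ℂ (fun z => Complex.exp (W z)) (ball 0 r) := by
    apply DifferentiableOn.diffContOnCl
    rw [closure_ball _ hr0.ne']
    exact (hW.mono hsub).cexp
  obtain ⟨z, hz, hmax⟩ := Complex.exists_mem_frontier_isMaxOn_norm isBounded_ball
    (nonempty_ball.2 hr0) hE
  rw [frontier_ball _ hr0.ne', mem_sphere_zero_iff_norm] at hz
  rw [closure_ball _ hr0.ne'] at hmax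
  have hle : ∀ w : ℂ, ‖w‖ ≤ r → (W w).re ≤ (W z).re := by
    intro w hw
    have := hmax (mem_closedBall_zero_iff.2 hw)
    simpa [Complex.norm_exp] using this
  have hzb : z ∈ ball (0 : ℂ) 1 := by rw [mem_ball_zero_iff, hz]; exact hr1
  have hd := hasDerivAt_of_differentiableOn_unitDisk hW hzb
  refine ⟨z, hz, hle, ?_, ?_⟩
  · have h1 : HasDerivAt (fun θ : ℝ => (W (z * Complex.exp (θ * Complex.I))).re)
        (deriv W z * (z * Complex.I)).re 0 := by
      have h2 : HasDerivAt (fun s : ℂ => z * Complex.exp (s * Complex.I)) (z * Complex.I)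
          ((0 : ℝ) : ℂ) := by
        have := (((hasDerivAt_id ((0 : ℝ) : ℂ)).mul_const Complex.I).cexp).const_mul z
        simpa using this
      have h3 : HasDerivAt W (deriv W z) (z * Complex.exp (((0 : ℝ) : ℂ) * Complex.I)) := by
        simpa using hd
      exact (h3.comp ((0 : ℝ) : ℂ) h2).real_of_complex
    have hloc : IsLocalMax (fun θ : ℝ => (W (z * Complex.exp (θ * Complex.I))).re) 0 := by
      refine Filter.Eventually.of_forall fun θ => ?_
      simp only [Complex.ofReal_zero, zero_mul, Complex.exp_zero, mul_one]
      apply hle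
      rw [norm_mul, Complex.norm_exp_ofReal_mul_I, mul_one, hz]
    have h4 := hloc.hasDerivAt_eq_zero h1
    have h5 : deriv W z * (z * Complex.I) = (z * deriv W z) * Complex.I := by ring
    rw [h5, Complex.mul_I_re] at h4
    linarith
  · have h1 : HasDerivAt (fun t : ℝ => (W (t * z)).re) (deriv W z * z).re 1 := by
      have h2 : HasDerivAt (fun s : ℂ => s * z) z ((1 : ℝ) : ℂ) := by
        simpa using (hasDerivAt_id ((1 : ℝ) : ℂ)).mul_const z
      have h3 : HasDerivAt W (deriv W z) (((1 : ℝ) : ℂ) * z) := by simpa using hd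
      exact (h3.comp ((1 : ℝ) : ℂ) h2).real_of_complex
    by_contra hneg
    push Not at hneg
    rw [mul_comm] at hneg
    -- a negative radial derivative makes `Re W` larger slightly inside the disk
    have h6 := (h1.hasDerivWithinAt (s := Iio 1))
    have h7 := h6.limsup_slope_le' (r := 0) (by simp) hneg
    have h8 : ∀ᶠ t : ℝ in nhdsWithin 1 (Iio 1), 0 < t :=
      Filter.Eventually.filter_mono nhdsWithin_le_nhds (lt_mem_nhds one_pos)
    obtain ⟨t, ht7, ht0, ht1⟩ := (h7.and (h8.and self_mem_nhdsWithin)).exists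
    have ht1' : t < 1 := ht1
    have hle' : (W (t * z)).re ≤ (W z).re := by
      apply hle
      rw [norm_mul, Complex.norm_real, Real.norm_of_nonneg ht0.le, hz]
      exact mul_le_of_le_one_left hr0.le ht1'.le
    rw [slope_def_field] at ht7
    have : 0 ≤ ((W (t * z)).re - (W ((1 : ℝ) * z)).re) / (t - 1) := by
      apply div_nonneg_of_nonpos <;> simp <;> linarith
    linarith

/-- If `z J' = 1 - J P` with `0 < Re P`, then `0 < Re J`: at a point where `Re J ≤ 0` is minimal,
`m = z J'` would be real and nonpositive, and `P = (1 - m) / J` would have `Re P ≤ 0`. -/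
theorem re_pos_of_euler_riccati {J P : ℂ → ℂ} (hJ : DifferentiableOn ℂ J (ball 0 1))
    (hP : ∀ z ∈ ball (0 : ℂ) 1, 0 < (P z).re)
    (h : ∀ z ∈ ball (0 : ℂ) 1, z * deriv J z = 1 - J z * P z) :
    ∀ z ∈ ball (0 : ℂ) 1, 0 < (J z).re := by
  intro w hw
  by_contra hneg
  push Not at hneg
  obtain ⟨r, hr1, hr2⟩ := exists_between (mem_ball_zero_iff.1 hw)
  have hr0 : 0 < r := lt_of_le_of_lt (norm_nonneg _) hr1
  obtain ⟨z, hz, hmax, him, hre⟩ := exists_max_re_on_closedBall hJ.neg hr0 hr2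
  have hzb : z ∈ ball (0 : ℂ) 1 := by rw [mem_ball_zero_iff, hz]; exact hr2
  have hJz : (J z).re ≤ 0 := by
    have := hmax w hr1.le
    simp at this
    linarith
  have hdn : deriv (-J) z = -deriv J z := by simp
  rw [hdn, mul_neg, h z hzb] at him hre
  have hPz := hP z hzb
  simp only [Complex.neg_im, Complex.sub_im, Complex.one_im, Complex.mul_im] at him
  simp only [Complex.neg_re, Complex.sub_re, Complex.one_re, Complex.mul_re] at hre
  -- `(1 - m) Re J = |J|² Re P`
  have h1 : (P z).re * ((J z).re ^ 2 + (J z).im ^ 2) =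
      (J z).re * ((J z).re * (P z).re - (J z).im * (P z).im) := by
    linear_combination (J z).im * him
  have h2 : (J z).re * ((J z).re * (P z).re - (J z).im * (P z).im) ≤ 0 :=
    mul_nonpos_of_nonpos_of_nonneg hJz (by linarith)
  have h3 : (J z).re ^ 2 + (J z).im ^ 2 ≤ 0 := by
    rw [← h1] at h2
    exact nonpos_of_mul_nonpos_right h2 hPz
  have h4 : (J z).re = 0 := by nlinarith [sq_nonneg (J z).re, sq_nonneg (J z).im]
  have h5 : (J z).im = 0 := by nlinarith [sq_nonneg (J z).re, sq_nonneg (J z).im]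
  rw [h4, h5] at hre
  norm_num at hre

/-- A first order differential subordination: if `0 < Re J` and `Re (W + J z W') ≤ 0`, then
`Re W ≤ 0`. -/
theorem re_nonpos_of_differential_subordination {J W : ℂ → ℂ}
    (hW : DifferentiableOn ℂ W (ball 0 1)) (hJ : ∀ z ∈ ball (0 : ℂ) 1, 0 < (J z).re)
    (h : ∀ z ∈ ball (0 : ℂ) 1, (W z + J z * (z * deriv W z)).re ≤ 0) :
    ∀ z ∈ ball (0 : ℂ) 1, (W z).re ≤ 0 := by
  intro w hw
  obtain ⟨r, hr1, hr2⟩ := exists_between (mem_ball_zero_iff.1 hw)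
  have hr0 : 0 < r := lt_of_le_of_lt (norm_nonneg _) hr1
  obtain ⟨z, hz, hmax, him, hre⟩ := exists_max_re_on_closedBall hW hr0 hr2
  have hzb : z ∈ ball (0 : ℂ) 1 := by rw [mem_ball_zero_iff, hz]; exact hr2
  have h1 := h z hzb
  rw [Complex.add_re, Complex.mul_re, him] at h1
  have := mul_nonneg (hJ z hzb).le hre
  linarith [hmax w hr1.le]

/-- A holomorphic function with nonpositive real part that vanishes somewhere is zero. -/
theorem eq_zero_of_re_nonpos_of_eq_zero {W : ℂ → ℂ} (hW : DifferentiableOn ℂ W (ball 0 1))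
    (h : ∀ z ∈ ball (0 : ℂ) 1, (W z).re ≤ 0) {z₀ : ℂ} (hz₀ : z₀ ∈ ball (0 : ℂ) 1)
    (h0 : W z₀ = 0) : ∀ z ∈ ball (0 : ℂ) 1, W z = 0 := by
  have hE : DifferentiableOn ℂ (fun z => W z - 1) (ball 0 1) := hW.sub_const 1
  have hne : ∀ z ∈ ball (0 : ℂ) 1, W z - 1 ≠ 0 := by
    intro z hz h1
    have := h z hz
    rw [sub_eq_zero.1 h1] at this
    norm_num at this
  -- `1 / (W - 1)` has maximal modulus at `z₀`
  have hm : IsMaxOn (norm ∘ fun z => (W z - 1)⁻¹) (ball 0 1) z₀ := by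
    intro z hz
    simp only [Function.comp, mem_ofPred_eq, norm_inv, h0]
    have : 1 ≤ ‖W z - 1‖ := by
      refine le_trans ?_ (Complex.abs_re_le_norm _)
      rw [le_abs]; right
      simp; linarith [h z hz]
    simpa using inv_le_one_of_one_le₀ this
  intro z hz
  have := Complex.eqOn_of_isPreconnected_of_isMaxOn_norm (convex_ball (0 : ℂ) 1).isPreconnected
    isOpen_ball (hE.inv hne) hz₀ hm hz
  have : (W z - 1)⁻¹ = (W z₀ - 1)⁻¹ := this
  rw [inv_inj, h0] at this
  linear_combination this

/-! ### The operator `f ↦ f' + α z f''` -/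

/-- The expression `f' + α z f''`. It is the derivative of `z ↦ valueG α z f`. -/
noncomputable def derivValueG (α : ℂ) (f : ℂ → ℂ) (z : ℂ) : ℂ :=
  deriv f z + α * z * deriv (deriv f) z

section ValueG

variable {α : ℂ} {f g : ℂ → ℂ}

theorem differentiableOn_derivValueG (hf : DifferentiableOn ℂ f (ball 0 1)) :
    DifferentiableOn ℂ (derivValueG α f) (ball 0 1) := by
  have h1 := hf.deriv isOpen_ball
  have h2 := h1.deriv isOpen_ball
  unfold derivValueG
  fun_prop

theorem derivValueG_zero (hf : NormalizedAnalytic f) : derivValueG α f 0 = 1 := by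
  simp [derivValueG, hf.2.2]

theorem hasDerivAt_derivValueG_zero (hf : DifferentiableOn ℂ f (ball 0 1)) :
    HasDerivAt (derivValueG α f) ((1 + α) * deriv (deriv f) 0) 0 := by
  have h0 : (0 : ℂ) ∈ ball (0 : ℂ) 1 := mem_ball_self one_pos
  have h1 := hf.deriv isOpen_ball
  have h2 := h1.deriv isOpen_ball
  have h3 := (hasDerivAt_of_differentiableOn_unitDisk h1 h0).add
    (((hasDerivAt_id (0 : ℂ)).const_mul α).mul (hasDerivAt_of_differentiableOn_unitDisk h2 h0))
  refine h3.congr_deriv ?_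
  simp; ring

theorem hasDerivAt_valueG (hf : DifferentiableOn ℂ f (ball 0 1)) {z : ℂ}
    (hz : z ∈ ball (0 : ℂ) 1) :
    HasDerivAt (fun z => valueG α z f) (derivValueG α f z) z := by
  have h1 := hasDerivAt_of_differentiableOn_unitDisk (hf.deriv isOpen_ball) hz
  have h2 := ((hasDerivAt_of_differentiableOn_unitDisk hf hz).const_mul (1 - α)).add
    (((hasDerivAt_id z).const_mul α).mul h1)
  refine h2.congr_deriv ?_
  simp [derivValueG]; ring

/-- The integral along the segment `[0, z]` of the derivative of a holomorphic function. -/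
theorem integral_segment_deriv {G p : ℂ → ℂ} (hp : ContinuousOn p (ball 0 1))
    (hG : ∀ z ∈ ball (0 : ℂ) 1, HasDerivAt G (p z) z) {z : ℂ} (hz : z ∈ ball (0 : ℂ) 1) :
    ∫ t in (0 : ℝ)..1, p (t * z) * z = G z - G 0 := by
  have hmem : ∀ t ∈ uIcc (0 : ℝ) 1, (t : ℂ) * z ∈ ball (0 : ℂ) 1 := fun t ht =>
    real_mul_mem_unitDisk hz (by rwa [uIcc_of_le zero_le_one] at ht)
  have hd : ∀ t ∈ uIcc (0 : ℝ) 1,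
      HasDerivAt (fun t : ℝ => G (t * z)) (p (t * z) * z) t := by
    intro t ht
    have h1 : HasDerivAt (fun s : ℂ => s * z) z (t : ℂ) := by
      simpa using (hasDerivAt_id (t : ℂ)).mul_const z
    exact ((hG _ (hmem t ht)).comp (t : ℂ) h1).comp_ofReal
  have hc : ContinuousOn (fun t : ℝ => p (t * z) * z) (uIcc 0 1) :=
    (hp.comp (by fun_prop) hmem).mul continuousOn_const
  rw [intervalIntegral.integral_eq_sub_of_hasDerivAt hd hc.intervalIntegrable]
  simp

theorem valueG_eq_integral (hf : NormalizedAnalytic f) {p : ℂ → ℂ}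
    (hp : EqOn (derivValueG α f) p (ball 0 1)) {z : ℂ} (hz : z ∈ ball (0 : ℂ) 1) :
    valueG α z f = ∫ t in (0 : ℝ)..1, p (t * z) * z := by
  rw [integral_segment_deriv ((differentiableOn_derivValueG hf.1).continuousOn.congr hp.symm)
    (G := fun z => valueG α z f) (fun w hw => hp hw ▸ hasDerivAt_valueG hf.1 hw) hz]
  simp [valueG, hf.2.1]

theorem inv_re_pos_of_re_pos (hα : 0 < α.re) : 0 < (α⁻¹).re := by
  rw [Complex.inv_re]
  exact div_pos hα (Complex.normSq_pos.2 fun h => by simp [h] at hα)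

theorem exists_derivValueG_eq (hα : 0 < α.re) {p : ℂ → ℂ} (hp : DifferentiableOn ℂ p (ball 0 1))
    (hp0 : p 0 = 1) :
    ∃ f, NormalizedAnalytic f ∧ EqOn (derivValueG α f) p (ball 0 1) := by
  have hα0 : α ≠ 0 := fun h => by simp [h] at hα
  have h0 : (0 : ℂ) ∈ ball (0 : ℂ) 1 := mem_ball_self one_pos
  obtain ⟨u, hu, hu'⟩ := euler_ode_exists (inv_re_pos_of_re_pos hα) (hp.const_mul α⁻¹)
  -- `f = z Y` is the primitive of `u` vanishing at `0`
  obtain ⟨Y, hY, hY'⟩ := euler_ode_exists (c := 1) (by simp) hu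
  have hd : ∀ z ∈ ball (0 : ℂ) 1, HasDerivAt (fun z => z * Y z) (u z) z := by
    intro z hz
    refine ((hasDerivAt_id z).mul (hasDerivAt_of_differentiableOn_unitDisk hY hz)).congr_deriv ?_
    simpa using hY' z hz
  have hEq : EqOn (deriv fun z => z * Y z) u (ball 0 1) := fun z hz => (hd z hz).deriv
  have hu0 : u 0 = 1 := by
    have := hu' 0 h0
    rw [hp0] at this
    field_simp at this
    simpa using this
  refine ⟨fun z => z * Y z, ⟨fun z hz => (hd z hz).differentiableAt.differentiableWithinAt,
    by simp, by rw [hEq h0, hu0]⟩, ?_⟩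
  intro z hz
  have h2 : deriv (deriv fun z => z * Y z) z = deriv u z :=
    (hEq.eventuallyEq_of_mem (isOpen_ball.mem_nhds hz)).deriv_eq
  have h3 := hu' z hz
  rw [derivValueG, h2, hEq hz]
  field_simp at h3
  linear_combination h3

theorem eqOn_of_derivValueG_eqOn (hα : 0 < α.re) (hf : NormalizedAnalytic f)
    (hg : NormalizedAnalytic g) (h : EqOn (derivValueG α f) (derivValueG α g) (ball 0 1)) :
    EqOn f g (ball 0 1) := by
  have hα0 : α ≠ 0 := fun h => by simp [h] at hα
  have h0 : (0 : ℂ) ∈ ball (0 : ℂ) 1 := mem_ball_self one_pos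
  have hf1 := hf.1.deriv isOpen_ball
  have hg1 := hg.1.deriv isOpen_ball
  have hz := euler_ode_unique (inv_re_pos_of_re_pos hα) (hf1.sub hg1) fun z hz => by
    have h1 := h hz
    have h2 : deriv (deriv f - deriv g) z = deriv (deriv f) z - deriv (deriv g) z :=
      ((hasDerivAt_of_differentiableOn_unitDisk hf1 hz).sub
        (hasDerivAt_of_differentiableOn_unitDisk hg1 hz)).deriv
    rw [derivValueG, derivValueG] at h1
    rw [h2, Pi.sub_apply]
    field_simp
    linear_combination h1
  exact isOpen_ball.eqOn_of_deriv_eq (convex_ball (0 : ℂ) 1).isPreconnected hf.1 hg.1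
    (fun z hz' => sub_eq_zero.1 (hz z hz')) h0 (by rw [hf.2.1, hg.2.1])

end ValueG

/-! ### The disk automorphism `δ(·, λ)` and the kernel `extremalP` -/

section Mobius

variable {lam : ℂ}

theorem one_add_conj_mul_ne_zero (hlam : ‖lam‖ < 1) {w : ℂ} (hw : ‖w‖ < 1) :
    1 + (starRingEnd ℂ) lam * w ≠ 0 := by
  intro h
  have h1 : ‖(starRingEnd ℂ) lam * w‖ < 1 := by
    rw [norm_mul, RCLike.norm_conj]
    exact mul_lt_one_of_nonneg_of_lt_one_left (norm_nonneg _) hlam hw.le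
  have h2 : (starRingEnd ℂ) lam * w = -1 := by linear_combination h
  rw [h2] at h1
  simp at h1

theorem norm_mobiusDelta_lt_one (hlam : ‖lam‖ < 1) {w : ℂ} (hw : ‖w‖ < 1) :
    ‖mobiusDelta w lam‖ < 1 := by
  have hne := one_add_conj_mul_ne_zero hlam hw
  rw [mobiusDelta, norm_div, div_lt_one (norm_pos_iff.2 hne)]
  apply lt_of_pow_lt_pow_left₀ 2 (norm_nonneg _)
  have h1 : ‖lam‖ ^ 2 < 1 := by nlinarith [norm_nonneg lam]
  have h2 : ‖w‖ ^ 2 < 1 := by nlinarith [norm_nonneg w]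
  have h3 := mul_pos (sub_pos.2 h1) (sub_pos.2 h2)
  simp only [← Complex.normSq_eq_norm_sq, Complex.normSq_apply] at h3 ⊢
  simp
  nlinarith

/-- `δ(·, -λ)` is the inverse of `δ(·, λ)`. -/
theorem mobiusDelta_mobiusDelta_neg (hlam : ‖lam‖ < 1) {w : ℂ} (hw : ‖w‖ < 1) :
    mobiusDelta (mobiusDelta w (-lam)) lam = w := by
  have h1 : 1 + (starRingEnd ℂ) (-lam) * w ≠ 0 := one_add_conj_mul_ne_zero (by simpa) hw
  have h2 := one_add_conj_mul_ne_zero hlam (norm_mobiusDelta_lt_one (lam := -lam) (by simpa) hw)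
  have h3 : mobiusDelta w (-lam) * (1 + (starRingEnd ℂ) (-lam) * w) = w + -lam :=
    div_mul_cancel₀ _ h1
  rw [mobiusDelta.eq_def (mobiusDelta w (-lam)) lam, div_eq_iff h2]
  rw [map_neg] at h3
  linear_combination h3

/-- The denominator of `1 / (1 - δ(x z, λ) z) = (1 + conj λ x z) / mobiusDenom λ x z`. -/
def mobiusDenom (lam x z : ℂ) : ℂ :=
  1 + ((starRingEnd ℂ) lam * x - lam) * z - x * z ^ 2

theorem norm_mobiusDelta_mul_lt_one (hlam : ‖lam‖ < 1) {x z : ℂ} (hz : ‖z‖ < 1)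
    (hxz : ‖x * z‖ < 1) : ‖mobiusDelta (x * z) lam * z‖ < 1 := by
  rw [norm_mul]
  exact mul_lt_one_of_nonneg_of_lt_one_left (norm_nonneg _) (norm_mobiusDelta_lt_one hlam hxz) hz.le

theorem one_sub_ne_zero_of_norm_lt {w : ℂ} (hw : ‖w‖ < 1) : 1 - w ≠ 0 := by
  intro h
  rw [← sub_eq_zero.1 h] at hw
  simp at hw

theorem mobiusDenom_eq (hlam : ‖lam‖ < 1) {x z : ℂ} (hxz : ‖x * z‖ < 1) :
    mobiusDenom lam x z =
      (1 + (starRingEnd ℂ) lam * (x * z)) * (1 - mobiusDelta (x * z) lam * z) := by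
  have := one_add_conj_mul_ne_zero hlam hxz
  rw [← mul_assoc] at this
  rw [mobiusDenom, mobiusDelta, ← mul_assoc]
  field_simp
  ring

theorem mobiusDenom_ne_zero (hlam : ‖lam‖ < 1) {x z : ℂ} (hz : ‖z‖ < 1) (hxz : ‖x * z‖ < 1) :
    mobiusDenom lam x z ≠ 0 := by
  rw [mobiusDenom_eq hlam hxz]
  exact mul_ne_zero (one_add_conj_mul_ne_zero hlam hxz)
    (one_sub_ne_zero_of_norm_lt (norm_mobiusDelta_mul_lt_one hlam hz hxz))

theorem extremalP_eq (β : ℝ) (hlam : ‖lam‖ < 1) {x z : ℂ} (hz : ‖z‖ < 1) (hxz : ‖x * z‖ < 1) :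
    extremalP β lam x z = (2 * (β : ℂ) - 1) +
      2 * (1 - (β : ℂ)) * (1 + (starRingEnd ℂ) lam * x * z) / mobiusDenom lam x z := by
  have h1 := one_add_conj_mul_ne_zero hlam hxz
  have h2 := one_sub_ne_zero_of_norm_lt (norm_mobiusDelta_mul_lt_one hlam hz hxz)
  rw [mobiusDenom_eq hlam hxz, extremalP, mul_assoc ((starRingEnd ℂ) lam) x z,
    mul_assoc (1 - 2 * (β : ℂ))]
  generalize mobiusDelta (x * z) lam * z = d at h2 ⊢
  generalize (starRingEnd ℂ) lam * (x * z) = e at h1 ⊢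
  field_simp
  ring

theorem extremalP_sub_extremalP (β : ℝ) (hlam : ‖lam‖ < 1) {x y z : ℂ} (hz : ‖z‖ < 1)
    (hxz : ‖x * z‖ < 1) (hyz : ‖y * z‖ < 1) :
    extremalP β lam x z - extremalP β lam y z =
      z ^ 2 * (2 * (1 - (β : ℂ)) * (1 - (starRingEnd ℂ) lam * lam) * (x - y) /
        (mobiusDenom lam x z * mobiusDenom lam y z)) := by
  have h1 := mobiusDenom_ne_zero hlam hz hxz
  have h2 := mobiusDenom_ne_zero hlam hz hyz
  rw [extremalP_eq β hlam hz hxz, extremalP_eq β hlam hz hyz]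
  field_simp
  rw [mobiusDenom, mobiusDenom]
  ring

end Mobius

/-! ### The class `𝒢(λ)` -/

section ClassG

variable {α : ℂ} {β : ℝ} {lam : ℂ} {f g : ℂ → ℂ}

/-- The half-plane `β < Re` is the image of the unit disk under `w ↦ (1 + (1 - 2β) w) / (1 - w)`,
with inverse `p ↦ (p - 1) / (p + 1 - 2β)`. -/
theorem subordinate_halfPlane_iff (hβ : β < 1) {p : ℂ → ℂ} (hp : DifferentiableOn ℂ p (ball 0 1))
    (hp0 : p 0 = 1) :
    Subordinate p (fun z => (1 + (1 - 2 * (β : ℂ)) * z) / (1 - z)) ↔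
      ∀ z ∈ ball (0 : ℂ) 1, β < (p z).re := by
  constructor
  · rintro ⟨ω, -, hmaps, -, heq⟩ z hz
    have hw := mem_ball_zero_iff.1 (hmaps hz)
    have h1 := one_sub_ne_zero_of_norm_lt hw
    rw [heq z hz]
    beta_reduce
    have h2 : (1 + (1 - 2 * (β : ℂ)) * ω z) / (1 - ω z) = β + (1 - (β : ℂ)) *
        ((1 + ω z) * (starRingEnd ℂ) (1 - ω z) / (Complex.normSq (1 - ω z) : ℂ)) := by
      have h3 : (starRingEnd ℂ) (1 - ω z) ≠ 0 := (map_ne_zero _).2 h1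
      rw [← Complex.mul_conj]
      field_simp
      ring
    rw [h2, ← Complex.ofReal_one, ← Complex.ofReal_sub, Complex.add_re, Complex.re_ofReal_mul,
      Complex.div_ofReal_re, Complex.ofReal_re]
    have h4 : 0 < Complex.normSq (1 - ω z) := Complex.normSq_pos.2 h1
    have h5 : 0 < ((1 + ω z) * (starRingEnd ℂ) (1 - ω z)).re := by
      have h6 : ‖ω z‖ ^ 2 < 1 := by nlinarith [norm_nonneg (ω z)]
      rw [← Complex.normSq_eq_norm_sq, Complex.normSq_apply] at h6
      simp
      nlinarith
    have := mul_pos (sub_pos.2 hβ) (div_pos h5 h4)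
    simpa using this
  · intro h
    have hne : ∀ z ∈ ball (0 : ℂ) 1, p z + 1 - 2 * (β : ℂ) ≠ 0 := by
      intro z hz h1
      have := congrArg Complex.re h1
      simp at this
      linarith [h z hz]
    refine ⟨fun z => (p z - 1) / (p z + 1 - 2 * (β : ℂ)), ?_, ?_, by simp [hp0], ?_⟩
    · exact (hp.sub_const 1).div ((hp.add_const 1).sub_const _) hne
    · intro z hz
      rw [mem_ball_zero_iff, norm_div, div_lt_one (norm_pos_iff.2 (hne z hz))]
      apply lt_of_pow_lt_pow_left₀ 2 (norm_nonneg _)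
      simp only [← Complex.normSq_eq_norm_sq, Complex.normSq_apply]
      simp
      nlinarith [mul_pos (sub_pos.2 hβ) (sub_pos.2 (h z hz))]
    · intro z hz
      have h1 := hne z hz
      have h2 : (1 - (β : ℂ)) ≠ 0 := by
        rw [sub_ne_zero]; exact_mod_cast hβ.ne'
      have h3 : 1 - (p z - 1) / (p z + 1 - 2 * (β : ℂ)) =
          2 * (1 - (β : ℂ)) / (p z + 1 - 2 * (β : ℂ)) := by
        field_simp; ring
      simp only
      rw [h3]
      field_simp
      ring

theorem hasDerivAt_halfPlane_comp (β : ℝ) {ω : ℂ → ℂ} {ω' : ℂ} (h : HasDerivAt ω ω' 0)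
    (h0 : ω 0 = 0) :
    HasDerivAt (fun z => (1 + (1 - 2 * (β : ℂ)) * ω z) / (1 - ω z)) (2 * (1 - (β : ℂ)) * ω') 0 := by
  refine (((h.const_mul (1 - 2 * (β : ℂ))).const_add 1).div (h.const_sub 1)
    (by simp [h0])).congr_deriv ?_
  simp [h0]; ring

/-- For the Schwarz function `ω` of `f ∈ ℱ(α, β)`, the normalization of `f''(0)` is `ω'(0) = λ`. -/
theorem deriv_deriv_zero_eq_iff (hα : 0 < α.re) (hβ : β < 1) (hf : NormalizedAnalytic f)
    {ω : ℂ → ℂ} (hω : DifferentiableOn ℂ ω (ball 0 1)) (hω0 : ω 0 = 0)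
    (heq : ∀ z ∈ ball (0 : ℂ) 1,
      derivValueG α f z = (1 + (1 - 2 * (β : ℂ)) * ω z) / (1 - ω z)) :
    deriv (deriv f) 0 = 2 * ((1 - (β : ℂ)) / (1 + α)) * lam ↔ deriv ω 0 = lam := by
  have h0 : (0 : ℂ) ∈ ball (0 : ℂ) 1 := mem_ball_self one_pos
  have h1 := hasDerivAt_derivValueG_zero (α := α) hf.1
  have h2 := hasDerivAt_halfPlane_comp β (hasDerivAt_of_differentiableOn_unitDisk hω h0) hω0
  have h3 := h1.unique (h2.congr_of_eventuallyEq
    (Filter.eventually_of_mem (isOpen_ball.mem_nhds h0) heq))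
  have hα1 : 1 + α ≠ 0 := by
    intro h
    have := congrArg Complex.re h
    simp at this
    linarith
  have hβ1 : (1 - (β : ℂ)) ≠ 0 := by
    rw [sub_ne_zero]; exact_mod_cast hβ.ne'
  constructor
  · intro h
    rw [h] at h3
    field_simp at h3
    exact h3.symm
  · intro h
    rw [h] at h3
    field_simp
    linear_combination h3

/-- The representation of a Schwarz function with derivative `λ` at `0`, from two applications of
the Schwarz lemma. -/
theorem exists_schwarz_parameter (hlam : ‖lam‖ < 1) {ω : ℂ → ℂ}
    (hω : DifferentiableOn ℂ ω (ball 0 1)) (hmaps : MapsTo ω (ball 0 1) (ball 0 1))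
    (hω0 : ω 0 = 0) (hω' : deriv ω 0 = lam) :
    ∃ χ : ℂ → ℂ, DifferentiableOn ℂ χ (ball 0 1) ∧ (∀ z ∈ ball (0 : ℂ) 1, ‖χ z‖ ≤ 1) ∧
      ∀ z ∈ ball (0 : ℂ) 1, ω z = mobiusDelta (χ z * z) lam * z := by
  have h0 : (0 : ℂ) ∈ ball (0 : ℂ) 1 := mem_ball_self one_pos
  have hmul : ∀ (k : ℂ → ℂ), k 0 = 0 → ∀ z, k z = dslope k 0 z * z := by
    intro k hk z
    have := sub_smul_dslope k 0 z
    simp only [sub_zero, hk, smul_eq_mul] at this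
    rw [mul_comm]; exact this.symm
  set ψ := dslope ω 0
  have hψ : DifferentiableOn ℂ ψ (ball 0 1) :=
    (Complex.differentiableOn_dslope (isOpen_ball.mem_nhds h0)).2 hω
  have hψ1 : ∀ z ∈ ball (0 : ℂ) 1, ‖ψ z‖ ≤ 1 := by
    intro z hz
    have hm : MapsTo ω (ball 0 1) (closedBall (ω 0) 1) := by
      rw [hω0]; exact hmaps.mono_right ball_subset_closedBall
    simpa using Complex.norm_dslope_le_div_of_mapsTo_ball hω hm hz
  have hψ0 : ψ 0 = lam := by rw [← hω']; exact dslope_same ω 0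
  have hψlt : ∀ z ∈ ball (0 : ℂ) 1, ‖ψ z‖ < 1 := by
    intro z hz
    refine lt_of_le_of_ne (hψ1 z hz) fun h => ?_
    have hm : IsMaxOn (norm ∘ ψ) (ball 0 1) z := by
      intro w hw
      simpa [h] using hψ1 w hw
    have := Complex.eqOn_of_isPreconnected_of_isMaxOn_norm (convex_ball (0 : ℂ) 1).isPreconnected
      isOpen_ball hψ hz hm h0
    simp only [Function.const] at this
    rw [← this, hψ0] at h
    exact hlam.ne h
  set φ : ℂ → ℂ := fun z => mobiusDelta (ψ z) (-lam)
  have hnl : ‖-lam‖ < 1 := by simpa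
  have hφ : DifferentiableOn ℂ φ (ball 0 1) := by
    have hne : ∀ z ∈ ball (0 : ℂ) 1, 1 + (starRingEnd ℂ) (-lam) * ψ z ≠ 0 := fun z hz =>
      one_add_conj_mul_ne_zero hnl (hψlt z hz)
    exact (hψ.add_const _).div ((hψ.const_mul _).const_add 1) hne
  have hφ0 : φ 0 = 0 := by simp [φ, mobiusDelta, hψ0]
  have hφlt : ∀ z ∈ ball (0 : ℂ) 1, ‖φ z‖ < 1 := fun z hz => norm_mobiusDelta_lt_one hnl (hψlt z hz)
  refine ⟨dslope φ 0, (Complex.differentiableOn_dslope (isOpen_ball.mem_nhds h0)).2 hφ, ?_, ?_⟩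
  · intro z hz
    have hm : MapsTo φ (ball 0 1) (closedBall (φ 0) 1) := by
      intro w hw
      rw [hφ0, mem_closedBall_zero_iff]; exact (hφlt w hw).le
    simpa using Complex.norm_dslope_le_div_of_mapsTo_ball hφ hm hz
  · intro z hz
    rw [← hmul φ hφ0, mobiusDelta_mobiusDelta_neg hlam (hψlt z hz)]
    exact hmul ω hω0 z

theorem norm_mul_lt_one_of_le {x z : ℂ} (hx : ‖x‖ ≤ 1) (hz : ‖z‖ < 1) : ‖x * z‖ < 1 := by
  rw [norm_mul]
  exact lt_of_le_of_lt (mul_le_of_le_one_left (norm_nonneg _) hx) hz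

theorem exists_parameter_of_mem_classG (hα : 0 < α.re) (hβ : β < 1) (hlam : ‖lam‖ < 1)
    (hf : f ∈ ClassG α β lam) :
    ∃ χ : ℂ → ℂ, DifferentiableOn ℂ χ (ball 0 1) ∧ (∀ z ∈ ball (0 : ℂ) 1, ‖χ z‖ ≤ 1) ∧
      ∀ z ∈ ball (0 : ℂ) 1, derivValueG α f z = extremalP β lam (χ z) z := by
  obtain ⟨⟨hn, ω, hω, hmaps, hω0, heq⟩, hf2⟩ := hf
  obtain ⟨χ, hχ, hχ1, hχω⟩ := exists_schwarz_parameter hlam hω hmaps hω0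
    ((deriv_deriv_zero_eq_iff hα hβ hn hω hω0 heq).1 hf2)
  refine ⟨χ, hχ, hχ1, fun z hz => ?_⟩
  have := heq z hz
  rw [hχω z hz] at this
  refine this.trans ?_
  beta_reduce
  rw [extremalP, ← mul_assoc]

theorem mem_classG_of_derivValueG_eq (hα : 0 < α.re) (hβ : β < 1) (hlam : ‖lam‖ < 1)
    (hf : NormalizedAnalytic f) {x : ℂ} (hx : ‖x‖ ≤ 1)
    (heq : EqOn (derivValueG α f) (extremalP β lam x) (ball 0 1)) :
    f ∈ ClassG α β lam := by
  have h0 : (0 : ℂ) ∈ ball (0 : ℂ) 1 := mem_ball_self one_pos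
  have hxz : ∀ z ∈ ball (0 : ℂ) 1, ‖x * z‖ < 1 := fun z hz =>
    norm_mul_lt_one_of_le hx (mem_ball_zero_iff.1 hz)
  have hδ : DifferentiableOn ℂ (fun z => mobiusDelta (x * z) lam) (ball 0 1) := by
    unfold mobiusDelta
    exact DifferentiableOn.div (by fun_prop) (by fun_prop)
      fun z hz => one_add_conj_mul_ne_zero hlam (hxz z hz)
  have hω : DifferentiableOn ℂ (fun z => mobiusDelta (x * z) lam * z) (ball 0 1) :=
    hδ.mul differentiableOn_id
  have heq' : ∀ z ∈ ball (0 : ℂ) 1, derivValueG α f z =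
      (1 + (1 - 2 * (β : ℂ)) * (mobiusDelta (x * z) lam * z)) /
        (1 - mobiusDelta (x * z) lam * z) := by
    intro z hz
    rw [heq hz, extremalP, ← mul_assoc]
  refine ⟨⟨hf, _, hω, ?_, by simp, heq'⟩, ?_⟩
  · intro z hz
    exact mem_ball_zero_iff.2
      (norm_mobiusDelta_mul_lt_one hlam (mem_ball_zero_iff.1 hz) (hxz z hz))
  · rw [deriv_deriv_zero_eq_iff hα hβ hf hω (by simp) heq']
    have := ((hasDerivAt_of_differentiableOn_unitDisk hδ h0).mul (hasDerivAt_id 0)).deriv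
    refine Eq.trans this ?_
    simp [mobiusDelta]

theorem differentiableOn_extremalP (β : ℝ) (hlam : ‖lam‖ < 1) {x : ℂ} (hx : ‖x‖ ≤ 1) :
    DifferentiableOn ℂ (extremalP β lam x) (ball 0 1) := by
  have hz1 : ∀ z ∈ ball (0 : ℂ) 1, ‖z‖ < 1 := fun z hz => mem_ball_zero_iff.1 hz
  have hxz : ∀ z ∈ ball (0 : ℂ) 1, ‖x * z‖ < 1 := fun z hz => norm_mul_lt_one_of_le hx (hz1 z hz)
  refine DifferentiableOn.congr (f := fun z => (2 * (β : ℂ) - 1) +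
    2 * (1 - (β : ℂ)) * (1 + (starRingEnd ℂ) lam * x * z) / mobiusDenom lam x z) ?_
    fun z hz => extremalP_eq β hlam (hz1 z hz) (hxz z hz)
  refine DifferentiableOn.const_add _ (DifferentiableOn.div (by fun_prop) ?_
    fun z hz => mobiusDenom_ne_zero hlam (hz1 z hz) (hxz z hz))
  unfold mobiusDenom
  fun_prop

theorem extremalP_zero (β : ℝ) (lam x : ℂ) : extremalP β lam x 0 = 1 := by
  simp [extremalP]

theorem exists_derivValueG_eq_extremalP (hα : 0 < α.re) (β : ℝ) (hlam : ‖lam‖ < 1)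
    {x : ℂ} (hx : ‖x‖ ≤ 1) :
    ∃ f, NormalizedAnalytic f ∧ EqOn (derivValueG α f) (extremalP β lam x) (ball 0 1) :=
  exists_derivValueG_eq hα (differentiableOn_extremalP β hlam hx) (extremalP_zero β lam x)

theorem isExtremalFunction_iff (hα : 0 < α.re) (hlam : ‖lam‖ < 1) {x : ℂ} (hx : ‖x‖ ≤ 1) :
    IsExtremalFunction α β lam x f ↔
      NormalizedAnalytic f ∧ EqOn (derivValueG α f) (extremalP β lam x) (ball 0 1) := by
  constructor
  · rintro ⟨hf, h⟩
    refine ⟨hf, ?_⟩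
    obtain ⟨g, hg, hgp⟩ := exists_derivValueG_eq_extremalP hα β hlam hx
    have heq : EqOn (fun z => valueG α z f) (fun z => valueG α z g) (ball 0 1) := fun z hz =>
      (h z hz).trans (valueG_eq_integral hg hgp hz).symm
    intro z hz
    rw [← hgp hz, ← (hasDerivAt_valueG hf.1 hz).deriv, ← (hasDerivAt_valueG hg.1 hz).deriv]
    exact (heq.eventuallyEq_of_mem (isOpen_ball.mem_nhds hz)).deriv_eq
  · rintro ⟨hf, h⟩
    exact ⟨hf, fun z hz => valueG_eq_integral hf h hz⟩

theorem convex_classG (α : ℂ) (hβ : β < 1) (lam : ℂ) :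
    Convex ℝ (ClassG α β lam) := by
  have h0 : (0 : ℂ) ∈ ball (0 : ℂ) 1 := mem_ball_self one_pos
  rintro f ⟨⟨hf, hfs⟩, hf2⟩ g ⟨⟨hg, hgs⟩, hg2⟩ a b ha hb hab
  have hab' : (a : ℂ) + b = 1 := by exact_mod_cast hab
  have hsm : a • f + b • g = fun z => (a : ℂ) * f z + (b : ℂ) * g z := by
    ext z; simp
  rw [hsm]
  have hD : DifferentiableOn ℂ (fun z => (a : ℂ) * f z + (b : ℂ) * g z) (ball 0 1) :=
    (hf.1.const_mul _).add (hg.1.const_mul _)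
  have hd : EqOn (deriv fun z => (a : ℂ) * f z + (b : ℂ) * g z)
      (fun z => (a : ℂ) * deriv f z + (b : ℂ) * deriv g z) (ball 0 1) := fun z hz =>
    (((hasDerivAt_of_differentiableOn_unitDisk hf.1 hz).const_mul _).add
      ((hasDerivAt_of_differentiableOn_unitDisk hg.1 hz).const_mul _)).deriv
  have hdd : ∀ z ∈ ball (0 : ℂ) 1, deriv (deriv fun z => (a : ℂ) * f z + (b : ℂ) * g z) z =
      (a : ℂ) * deriv (deriv f) z + (b : ℂ) * deriv (deriv g) z := fun z hz => by
    rw [(hd.eventuallyEq_of_mem (isOpen_ball.mem_nhds hz)).deriv_eq]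
    exact (((hasDerivAt_of_differentiableOn_unitDisk (hf.1.deriv isOpen_ball) hz).const_mul _).add
      ((hasDerivAt_of_differentiableOn_unitDisk (hg.1.deriv isOpen_ball) hz).const_mul _)).deriv
  have hN : NormalizedAnalytic fun z => (a : ℂ) * f z + (b : ℂ) * g z := by
    refine ⟨hD, by simp [hf.2.1, hg.2.1], ?_⟩
    rw [hd h0]
    simp [hf.2.2, hg.2.2, hab']
  refine ⟨⟨hN, ?_⟩, ?_⟩
  · refine (subordinate_halfPlane_iff hβ (differentiableOn_derivValueG (α := α) hD)
      (derivValueG_zero hN)).2 fun z hz => ?_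
    have h1 := (subordinate_halfPlane_iff hβ (differentiableOn_derivValueG (α := α) hf.1)
      (derivValueG_zero hf)).1 hfs z hz
    have h2 := (subordinate_halfPlane_iff hβ (differentiableOn_derivValueG (α := α) hg.1)
      (derivValueG_zero hg)).1 hgs z hz
    have h3 : derivValueG α (fun z => (a : ℂ) * f z + (b : ℂ) * g z) z =
        (a : ℂ) * derivValueG α f z + (b : ℂ) * derivValueG α g z := by
      rw [derivValueG, hdd z hz, hd hz, derivValueG, derivValueG]
      ring
    rw [h3, Complex.add_re, Complex.re_ofReal_mul, Complex.re_ofReal_mul]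
    exact convex_Ioi β h1 h2 ha hb hab
  · rw [hdd 0 h0, hf2, hg2, ← add_mul, hab', one_mul]

theorem convex_regionG (α : ℂ) (hβ : β < 1) {z₀ : ℂ} (hz₀ : ‖z₀‖ < 1) (lam : ℂ) :
    Convex ℝ (regionG α β z₀ lam) := by
  rintro _ ⟨f, hf, rfl⟩ _ ⟨g, hg, rfl⟩ a b ha hb hab
  refine ⟨a • f + b • g, convex_classG α hβ lam hf hg ha hb hab, ?_⟩
  have hz : z₀ ∈ ball (0 : ℂ) 1 := mem_ball_zero_iff.2 hz₀
  have hd : deriv (a • f + b • g) z₀ = a • deriv f z₀ + b • deriv g z₀ :=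
    (((hasDerivAt_of_differentiableOn_unitDisk hf.1.1.1 hz).const_smul a).add
      ((hasDerivAt_of_differentiableOn_unitDisk hg.1.1.1 hz).const_smul b)).deriv
  rw [valueG, hd, valueG, valueG]
  simp only [Pi.add_apply, Pi.smul_apply, Complex.real_smul]
  ring

end ClassG

/-! ### Supporting half-planes of the region of variability -/

/-- The Möbius map `v ↦ (v - 1) (A + B) / (A + B v)` sends the closed unit disk to a disk that
touches the imaginary axis at `0` from the left. -/
theorem re_mobius_nonpos {A B v : ℂ} (hAB : ‖B‖ ≤ ‖A‖) (hv : ‖v‖ ≤ 1) :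
    ((v - 1) * (A + B) / (A + B * v)).re ≤ 0 := by
  have h1 : (v - 1) * (A + B) / (A + B * v) =
      (v - 1) * (A + B) * (starRingEnd ℂ) (A + B * v) / (Complex.normSq (A + B * v) : ℂ) := by
    rcases eq_or_ne (A + B * v) 0 with h | h
    · simp [h]
    · have h2 : (starRingEnd ℂ) (A + B * v) ≠ 0 := (map_ne_zero _).2 h
      rw [← Complex.mul_conj, mul_div_mul_right _ _ h2]
  rw [h1, Complex.div_ofReal_re]
  refine div_nonpos_of_nonpos_of_nonneg ?_ (Complex.normSq_nonneg _)
  have h2 : ((v - 1) * (A + B) * (starRingEnd ℂ) (A + B * v)).re =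
      -((Complex.normSq A - Complex.normSq B) * Complex.normSq (v - 1) +
        (1 - Complex.normSq v) * Complex.normSq (A + B)) / 2 := by
    simp [Complex.normSq_apply]
    ring
  have h3 : 0 ≤ Complex.normSq A - Complex.normSq B := by
    rw [Complex.normSq_eq_norm_sq, Complex.normSq_eq_norm_sq, sub_nonneg]
    gcongr
  have h4 : 0 ≤ 1 - Complex.normSq v := by
    rw [Complex.normSq_eq_norm_sq]
    nlinarith [norm_nonneg v]
  rw [h2]
  have := mul_nonneg h3 (Complex.normSq_nonneg (v - 1))
  have := mul_nonneg h4 (Complex.normSq_nonneg (A + B))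
  linarith

section Support

variable {α : ℂ} {β : ℝ} {lam a : ℂ} {f g : ℂ → ℂ}

/-- Among the kernels with parameter `x` in the closed disk, the one with parameter `a` on the
circle is extremal in the direction of `a z² / mobiusDenom λ a z ^ 2`. -/
theorem re_kernel_nonpos (hlam : ‖lam‖ < 1) (ha : ‖a‖ = 1) {x z : ℂ} (hx : ‖x‖ ≤ 1) (hz : ‖z‖ < 1) :
    ((starRingEnd ℂ) a * (x - a) * mobiusDenom lam a z / mobiusDenom lam x z).re ≤ 0 := by
  have haa : a * (starRingEnd ℂ) a = 1 := by
    rw [Complex.mul_conj, Complex.normSq_eq_norm_sq, ha]; norm_num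
  have h1 : ‖((starRingEnd ℂ) lam - z) * z * a‖ ≤ ‖1 - lam * z‖ := by
    have hl : ‖(starRingEnd ℂ) lam‖ < 1 := by rwa [RCLike.norm_conj]
    have hz' : ‖-z‖ < 1 := by rwa [norm_neg]
    have h2 := norm_mobiusDelta_lt_one hl hz'
    have h3 := one_add_conj_mul_ne_zero hl hz'
    rw [mobiusDelta, norm_div, div_lt_one (norm_pos_iff.2 h3), Complex.conj_conj] at h2
    have h4 : -z + (starRingEnd ℂ) lam = (starRingEnd ℂ) lam - z := by ring
    have h5 : 1 + lam * -z = 1 - lam * z := by ring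
    rw [h4, h5] at h2
    rw [norm_mul, norm_mul, ha, mul_one]
    exact (mul_le_of_le_one_right (norm_nonneg _) hz.le).trans h2.le
  have hv : ‖x * (starRingEnd ℂ) a‖ ≤ 1 := by
    rw [norm_mul, RCLike.norm_conj, ha, mul_one]; exact hx
  have h6 := re_mobius_nonpos h1 hv
  have h7 : 1 - lam * z + ((starRingEnd ℂ) lam - z) * z * a = mobiusDenom lam a z := by
    rw [mobiusDenom]; ring
  have h8 : 1 - lam * z + ((starRingEnd ℂ) lam - z) * z * a * (x * (starRingEnd ℂ) a) =
      mobiusDenom lam x z := by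
    rw [mobiusDenom]
    linear_combination ((starRingEnd ℂ) lam - z) * z * x * haa
  have h9 : x * (starRingEnd ℂ) a - 1 = (starRingEnd ℂ) a * (x - a) := by
    linear_combination haa
  rwa [h7, h8, h9] at h6

/-- `z / mobiusDenom λ a z` is starlike: its logarithmic derivative times `z` is
`(1 + a z²) / mobiusDenom λ a z`. -/
theorem re_starlike_pos (hlam : ‖lam‖ < 1) (ha : ‖a‖ = 1) {z : ℂ} (hz : ‖z‖ < 1) :
    0 < ((1 + a * z ^ 2) / mobiusDenom lam a z).re := by
  have haa : a * (starRingEnd ℂ) a = 1 := by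
    rw [Complex.mul_conj, Complex.normSq_eq_norm_sq, ha]; norm_num
  have hD := mobiusDenom_ne_zero hlam hz (norm_mul_lt_one_of_le ha.le hz)
  have h1 : (1 + a * z ^ 2) / mobiusDenom lam a z =
      (1 + a * z ^ 2) * (starRingEnd ℂ) (mobiusDenom lam a z) /
        (Complex.normSq (mobiusDenom lam a z) : ℂ) := by
    have h2 : (starRingEnd ℂ) (mobiusDenom lam a z) ≠ 0 := (map_ne_zero _).2 hD
    rw [← Complex.mul_conj, mul_div_mul_right _ _ h2]
  rw [h1, Complex.div_ofReal_re]
  refine div_pos ?_ (Complex.normSq_pos.2 hD)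
  set m := ((starRingEnd ℂ) lam * a - lam) * z with hm
  have h3 : (1 + a * z ^ 2) * (starRingEnd ℂ) (mobiusDenom lam a z) =
      (1 - (z * (starRingEnd ℂ) z) ^ 2) + (a * z ^ 2 - (starRingEnd ℂ) (a * z ^ 2)) +
        ((starRingEnd ℂ) m - z * (starRingEnd ℂ) z * m) := by
    simp only [mobiusDenom, hm, map_add, map_sub, map_mul, map_one, map_pow, Complex.conj_conj]
    linear_combination (lam * z ^ 2 * (starRingEnd ℂ) z - z ^ 2 * (starRingEnd ℂ) z ^ 2) * haa
  have h4 : ‖m‖ ≤ 2 * ‖lam‖ * ‖z‖ := by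
    rw [hm, norm_mul]
    gcongr
    refine (norm_sub_le _ _).trans ?_
    rw [norm_mul, RCLike.norm_conj, ha]
    linarith
  have h5 : -‖m‖ ≤ m.re := (abs_le.1 (Complex.abs_re_le_norm m)).1
  have h6 : ((1 + a * z ^ 2) * (starRingEnd ℂ) (mobiusDenom lam a z)).re =
      (1 - ‖z‖ ^ 2) * (1 + ‖z‖ ^ 2 + m.re) := by
    rw [h3, Complex.mul_conj, Complex.normSq_eq_norm_sq]
    simp only [Complex.add_re, Complex.sub_re, Complex.conj_re, Complex.re_ofReal_mul,
      ← Complex.ofReal_pow, Complex.ofReal_re, Complex.one_re]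
    ring
  rw [h6]
  have h7 : ‖lam‖ * ‖z‖ ≤ ‖z‖ := mul_le_of_le_one_left (norm_nonneg _) hlam.le
  refine mul_pos (by nlinarith [norm_nonneg z]) ?_
  nlinarith [sq_nonneg (1 - ‖z‖), mul_pos (sub_pos.2 hz) (sub_pos.2 hz)]

/-- With `D = mobiusDenom λ a`, the primitive `z³ H` of `z² / D²` is starlike: `J = H D²`, the
reciprocal of the logarithmic derivative of `z³ H` times `z`, has positive real part. -/
theorem exists_starlike_primitive (hlam : ‖lam‖ < 1) (ha : ‖a‖ = 1) :
    ∃ H : ℂ → ℂ, DifferentiableOn ℂ H (ball 0 1) ∧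
      (∀ z ∈ ball (0 : ℂ) 1, 3 * H z + z * deriv H z = (mobiusDenom lam a z ^ 2)⁻¹) ∧
      ∀ z ∈ ball (0 : ℂ) 1, 0 < (H z * mobiusDenom lam a z ^ 2).re := by
  have hD : ∀ z ∈ ball (0 : ℂ) 1, mobiusDenom lam a z ≠ 0 := fun z hz =>
    mobiusDenom_ne_zero hlam (mem_ball_zero_iff.1 hz)
      (norm_mul_lt_one_of_le ha.le (mem_ball_zero_iff.1 hz))
  have hDd : Differentiable ℂ (mobiusDenom lam a) := by
    unfold mobiusDenom; fun_prop
  have hDderiv : ∀ z, z * deriv (mobiusDenom lam a) z = mobiusDenom lam a z - (1 + a * z ^ 2) := by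
    intro z
    have h1 : HasDerivAt (mobiusDenom lam a)
        (((starRingEnd ℂ) lam * a - lam) - a * (2 * z)) z := by
      refine ((((hasDerivAt_id z).const_mul ((starRingEnd ℂ) lam * a - lam)).const_add 1).sub
        (((hasDerivAt_id z).pow 2).const_mul a)).congr_deriv ?_
      simp
    rw [h1.deriv, mobiusDenom]
    ring
  obtain ⟨H, hH, hHe⟩ := euler_ode_exists (c := 3) (by norm_num)
    (G := fun z => (mobiusDenom lam a z ^ 2)⁻¹)
    ((hDd.pow 2).differentiableOn.inv fun z hz => pow_ne_zero 2 (hD z hz))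
  refine ⟨H, hH, hHe, ?_⟩
  refine re_pos_of_euler_riccati (P := fun z => 1 + 2 * ((1 + a * z ^ 2) / mobiusDenom lam a z))
    (hH.mul (hDd.pow 2).differentiableOn) ?_ ?_
  · intro z hz
    have := re_starlike_pos hlam ha (mem_ball_zero_iff.1 hz)
    simp only [Complex.add_re, Complex.one_re, Complex.mul_re, Complex.re_ofNat, Complex.im_ofNat,
      zero_mul, sub_zero]
    linarith
  · intro z hz
    have h1 : deriv (fun z => H z * mobiusDenom lam a z ^ 2) z =
        deriv H z * mobiusDenom lam a z ^ 2 +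
          H z * (2 * mobiusDenom lam a z * deriv (mobiusDenom lam a) z) := by
      refine (((hasDerivAt_of_differentiableOn_unitDisk hH hz).mul
        ((hDd z).hasDerivAt.pow 2)).congr_deriv ?_).deriv
      simp
    have h2 := hHe z hz
    have h3 := hDderiv z
    have h4 := hD z hz
    rw [h1]
    beta_reduce at h2
    field_simp at h2 ⊢
    linear_combination h2 + 2 * H z * mobiusDenom lam a z * h3

/-- The region of variability lies on one side of a line through the point given by the extremal
function with parameter `a`, and that point is attained by no other function. If `X` is the
difference of the two functions `z ↦ valueG α z ·`, then `conj a X' / (z² / D²)` has nonpositive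
real part; the differential subordination transfers this to the quotient of the primitives. -/
theorem exists_supporting_direction (hα : 0 < α.re) (hβ : β < 1) (hlam : ‖lam‖ < 1) (ha : ‖a‖ = 1)
    {z₀ : ℂ} (hz₀ : ‖z₀‖ < 1) (hz₀' : z₀ ≠ 0) :
    ∃ n : ℂ, n ≠ 0 ∧ ∀ f ∈ ClassG α β lam, ∀ g, NormalizedAnalytic g →
      EqOn (derivValueG α g) (extremalP β lam a) (ball 0 1) →
        (n * (valueG α z₀ f - valueG α z₀ g)).re ≤ 0 ∧
          (valueG α z₀ f = valueG α z₀ g →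
            EqOn (derivValueG α f) (derivValueG α g) (ball 0 1)) := by
  obtain ⟨H, hH, hHe, hHpos⟩ := exists_starlike_primitive hlam ha
  have h0 : (0 : ℂ) ∈ ball (0 : ℂ) 1 := mem_ball_self one_pos
  have hz₀b : z₀ ∈ ball (0 : ℂ) 1 := mem_ball_zero_iff.2 hz₀
  have ha0 : (starRingEnd ℂ) a ≠ 0 := (map_ne_zero _).2 fun h => by simp [h] at ha
  have hH0 : ∀ z ∈ ball (0 : ℂ) 1, H z ≠ 0 := fun z hz h => by
    have := hHpos z hz
    simp [h] at this
  have hz1 : ∀ z ∈ ball (0 : ℂ) 1, ‖z‖ < 1 := fun z hz => mem_ball_zero_iff.1 hz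
  have hD : ∀ z ∈ ball (0 : ℂ) 1, mobiusDenom lam a z ≠ 0 := fun z hz =>
    mobiusDenom_ne_zero hlam (hz1 z hz) (norm_mul_lt_one_of_le ha.le (hz1 z hz))
  refine ⟨(starRingEnd ℂ) a / (z₀ ^ 3 * H z₀), div_ne_zero ha0
    (mul_ne_zero (pow_ne_zero 3 hz₀') (hH0 z₀ hz₀b)), fun f hf g hg hgp => ?_⟩
  obtain ⟨χ, hχ, hχ1, hχp⟩ := exists_parameter_of_mem_classG hα hβ hlam hf
  have hDχ : ∀ z ∈ ball (0 : ℂ) 1, mobiusDenom lam (χ z) z ≠ 0 := fun z hz =>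
    mobiusDenom_ne_zero hlam (hz1 z hz) (norm_mul_lt_one_of_le (hχ1 z hz) (hz1 z hz))
  set Y : ℂ → ℂ := fun z => 2 * (1 - (β : ℂ)) * (1 - (starRingEnd ℂ) lam * lam) * (χ z - a) /
        (mobiusDenom lam (χ z) z * mobiusDenom lam a z) with hYdef
  have hY : DifferentiableOn ℂ Y (ball 0 1) := by
    refine DifferentiableOn.div (by fun_prop) ?_ fun z hz => mul_ne_zero (hDχ z hz) (hD z hz)
    unfold mobiusDenom
    fun_prop
  have hXd : ∀ z ∈ ball (0 : ℂ) 1, derivValueG α f z - derivValueG α g z = z ^ 2 * Y z := by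
    intro z hz
    rw [hχp z hz, hgp hz]
    exact extremalP_sub_extremalP β hlam (hz1 z hz) (norm_mul_lt_one_of_le (hχ1 z hz) (hz1 z hz))
      (norm_mul_lt_one_of_le ha.le (hz1 z hz))
  obtain ⟨X, hX, hXe⟩ := euler_ode_exists (c := 3) (by norm_num) hY
  have hXeq : EqOn (fun z => valueG α z f - valueG α z g) (fun z => z ^ 3 * X z) (ball 0 1) := by
    have hd1 : ∀ z ∈ ball (0 : ℂ) 1, HasDerivAt (fun z => valueG α z f - valueG α z g)
        (z ^ 2 * Y z) z := fun z hz => by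
      rw [← hXd z hz]
      exact (hasDerivAt_valueG hf.1.1.1 hz).sub (hasDerivAt_valueG hg.1 hz)
    have hd2 : ∀ z ∈ ball (0 : ℂ) 1, HasDerivAt (fun z => z ^ 3 * X z) (z ^ 2 * Y z) z :=
      fun z hz => by
        refine (((hasDerivAt_id z).pow 3).mul
          (hasDerivAt_of_differentiableOn_unitDisk hX hz)).congr_deriv ?_
        rw [← hXe z hz]
        simp
        ring
    refine isOpen_ball.eqOn_of_deriv_eq (convex_ball (0 : ℂ) 1).isPreconnected
      (fun z hz => (hd1 z hz).differentiableAt.differentiableWithinAt)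
      (fun z hz => (hd2 z hz).differentiableAt.differentiableWithinAt)
      (fun z hz => by rw [(hd1 z hz).deriv, (hd2 z hz).deriv]) h0 ?_
    simp [valueG, hf.1.1.2.1, hg.2.1]
  set W : ℂ → ℂ := fun z => (starRingEnd ℂ) a * (X z / H z) with hWdef
  have hW : DifferentiableOn ℂ W (ball 0 1) := (hX.div hH hH0).const_mul _
  have hWre : ∀ z ∈ ball (0 : ℂ) 1, (W z).re ≤ 0 := by
    refine re_nonpos_of_differential_subordination hW hHpos fun z hz => ?_
    have hd : deriv W z = (starRingEnd ℂ) a *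
        ((deriv X z * H z - X z * deriv H z) / H z ^ 2) :=
      (((hasDerivAt_of_differentiableOn_unitDisk hX hz).div
        (hasDerivAt_of_differentiableOn_unitDisk hH hz) (hH0 z hz)).const_mul _).deriv
    have hsum : W z + H z * mobiusDenom lam a z ^ 2 * (z * deriv W z) =
        (starRingEnd ℂ) a * (Y z * mobiusDenom lam a z ^ 2) := by
      have h1 := hHe z hz
      have h2 := hXe z hz
      have h3 := hH0 z hz
      have h4 := hD z hz
      rw [hd, ← h2]
      simp only [hWdef]
      field_simp at h1 ⊢
      linear_combination (-X z) * h1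
    have hl : (1 - (starRingEnd ℂ) lam * lam) = ((1 - ‖lam‖ ^ 2 : ℝ) : ℂ) := by
      rw [mul_comm, Complex.mul_conj, Complex.normSq_eq_norm_sq]; push_cast; rfl
    have hY2 : (starRingEnd ℂ) a * (Y z * mobiusDenom lam a z ^ 2) =
        ((2 * (1 - β) * (1 - ‖lam‖ ^ 2) : ℝ) : ℂ) *
          ((starRingEnd ℂ) a * (χ z - a) * mobiusDenom lam a z / mobiusDenom lam (χ z) z) := by
      have h4 := hD z hz
      have h5 := hDχ z hz
      simp only [hYdef, hl]
      field_simp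
      push_cast
      ring
    rw [hsum, hY2, Complex.re_ofReal_mul]
    refine mul_nonpos_of_nonneg_of_nonpos ?_ (re_kernel_nonpos hlam ha (hχ1 z hz) (hz1 z hz))
    have : 0 < 1 - ‖lam‖ ^ 2 := by nlinarith [norm_nonneg lam]
    have : 0 < 1 - β := sub_pos.2 hβ
    positivity
  have hnW : (starRingEnd ℂ) a / (z₀ ^ 3 * H z₀) * (valueG α z₀ f - valueG α z₀ g) = W z₀ := by
    have h1 := hXeq hz₀b
    beta_reduce at h1
    rw [h1]
    have := hH0 z₀ hz₀b
    simp only [hWdef]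
    field_simp
  refine ⟨hnW ▸ hWre z₀ hz₀b, fun heq z hz => ?_⟩
  -- equality at `z₀` forces `W = 0`, hence `X = 0` and `Y = 0`
  rw [heq, sub_self, mul_zero] at hnW
  have hX0 : EqOn X 0 (ball 0 1) := by
    intro w hw
    have := eq_zero_of_re_nonpos_of_eq_zero hW hWre hz₀b hnW.symm w hw
    simpa [hWdef, ha0, hH0 w hw] using this
  have hXd0 : deriv X z = 0 := by
    rw [(hX0.eventuallyEq_of_mem (isOpen_ball.mem_nhds hz)).deriv_eq]
    simp
  have hY0 := hXe z hz
  rw [hX0 hz, hXd0] at hY0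
  have := hXd z hz
  rw [← hY0] at this
  simpa [sub_eq_zero] using this

end Support

/-! ### The boundary of a convex region containing a holomorphic disk -/

/-- The image of the open disk is open, hence lies in the interior of `V`; since the closed disk has
compact image and its boundary circle stays on the frontier, the image of the open disk is also
relatively closed in the interior of `V`, which is connected. So it is the whole interior. -/
theorem frontier_eq_image_sphere {V : Set ℂ} (hV : Convex ℝ V) {Γ : ℂ → ℂ}
    (hΓc : ContinuousOn Γ (closedBall 0 1)) (hΓd : DifferentiableOn ℂ Γ (ball 0 1))
    (hΓ : ¬∃ w, ∀ z ∈ ball (0 : ℂ) 1, Γ z = w) (hmem : MapsTo Γ (closedBall 0 1) V)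
    (hfr : MapsTo Γ (sphere 0 1) (frontier V)) : frontier V = Γ '' sphere 0 1 := by
  have hopen : IsOpen (Γ '' ball 0 1) :=
    (((hΓd.analyticOnNhd isOpen_ball).is_constant_or_isOpen
      (convex_ball (0 : ℂ) 1).isPreconnected).resolve_left hΓ) _ Subset.rfl isOpen_ball
  have hsub : Γ '' ball 0 1 ⊆ interior V :=
    interior_maximal (image_subset_iff.2 fun z hz => hmem (ball_subset_closedBall hz)) hopen
  have hne : (Γ '' ball 0 1).Nonempty := (nonempty_ball.2 one_pos).image _
  have hclosed : IsClosed (Γ '' closedBall 0 1) :=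
    ((isCompact_closedBall (0 : ℂ) 1).image_of_continuousOn hΓc).isClosed
  have hcases : ∀ z ∈ closedBall (0 : ℂ) 1, z ∈ ball (0 : ℂ) 1 ∨ z ∈ sphere (0 : ℂ) 1 := by
    intro z hz
    rw [← mem_union, ball_union_sphere]
    exact hz
  have hint : interior V ⊆ Γ '' ball 0 1 := by
    refine hV.interior.isPreconnected.subset_of_closure_inter_subset hopen ?_ ?_
    · obtain ⟨w, hw⟩ := hne
      exact ⟨w, hsub hw, hw⟩
    · rintro w ⟨hw, hwV⟩
      obtain ⟨z, hz, rfl⟩ := closure_minimal (image_mono ball_subset_closedBall) hclosed hw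
      rcases hcases z hz with h | h
      · exact mem_image_of_mem _ h
      · exact absurd hwV (hfr h).2
  refine Subset.antisymm (fun w hw => ?_) (image_subset_iff.2 hfr)
  have h1 : w ∈ closure (interior V) := by
    rw [hV.closure_interior_eq_closure_of_nonempty_interior (hne.mono hsub)]
    exact hw.1
  obtain ⟨z, hz, rfl⟩ := closure_minimal
    (hint.trans (image_mono ball_subset_closedBall)) hclosed h1
  rcases hcases z hz with h | h
  · exact absurd (hsub (mem_image_of_mem _ h)) hw.2
  · exact mem_image_of_mem _ h

theorem mem_frontier_of_re_le {V : Set ℂ} {v n : ℂ} (hv : v ∈ V) (hn : n ≠ 0)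
    (h : ∀ w ∈ V, (n * (w - v)).re ≤ 0) : v ∈ frontier V := by
  refine ⟨subset_closure hv, fun hint => ?_⟩
  -- moving from `v` in the direction `n⁻¹` leaves `V`
  have hc : Filter.Tendsto (fun t : ℝ => v + t * n⁻¹) (nhds 0) (nhds v) := by
    have : Continuous fun t : ℝ => v + t * n⁻¹ := by fun_prop
    simpa using this.tendsto 0
  have h1 : ∀ᶠ t : ℝ in nhdsWithin 0 (Ioi 0), v + t * n⁻¹ ∈ V :=
    (hc.eventually (mem_interior_iff_mem_nhds.1 hint)).filter_mono nhdsWithin_le_nhds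
  obtain ⟨t, ht, ht0⟩ := (h1.and self_mem_nhdsWithin).exists
  have h2 := h _ ht
  have h3 : n * (v + t * n⁻¹ - v) = t := by field_simp; ring
  rw [h3, Complex.ofReal_re] at h2
  exact absurd ht0 (not_lt.2 h2)

/-! ### The extremal values as a holomorphic function of the parameter -/

section ExtremalValue

variable {β : ℝ} {lam z₀ : ℂ}

/-- The value at `z₀` of the functional on the extremal function with parameter `a`, where `a` may be
any point with `‖a‖ * ‖z₀‖ < 1`. -/
noncomputable def extremalValue (β : ℝ) (lam z₀ a : ℂ) : ℂ :=
  ∫ t in (0 : ℝ)..1, extremalP β lam a (t * z₀) * z₀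

theorem hasDerivAt_extremalP_param (β : ℝ) (hlam : ‖lam‖ < 1) {x z : ℂ} (hz : ‖z‖ < 1)
    (hxz : ‖x * z‖ < 1) :
    HasDerivAt (fun x => extremalP β lam x z)
      (z ^ 2 * (2 * (1 - (β : ℂ)) * (1 - (starRingEnd ℂ) lam * lam) / mobiusDenom lam x z ^ 2))
      x := by
  have hD := mobiusDenom_ne_zero hlam hz hxz
  have hopen : IsOpen {y : ℂ | ‖y * z‖ < 1} := isOpen_lt (by fun_prop) continuous_const
  have heq : (fun y => extremalP β lam y z) =ᶠ[nhds x] fun y => (2 * (β : ℂ) - 1) +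
      2 * (1 - (β : ℂ)) * (1 + (starRingEnd ℂ) lam * y * z) / mobiusDenom lam y z :=
    Filter.eventually_of_mem (hopen.mem_nhds hxz) fun y hy => extremalP_eq β hlam hz hy
  have h1 : HasDerivAt (fun y => mobiusDenom lam y z) ((starRingEnd ℂ) lam * z - z ^ 2) x := by
    refine ((((((hasDerivAt_id x).const_mul ((starRingEnd ℂ) lam)).sub_const lam).mul_const
      z).const_add 1).sub ((hasDerivAt_id x).mul_const (z ^ 2))).congr_deriv ?_
    simp
  have h2 : HasDerivAt (fun y => 2 * (1 - (β : ℂ)) * (1 + (starRingEnd ℂ) lam * y * z))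
      (2 * (1 - (β : ℂ)) * ((starRingEnd ℂ) lam * z)) x := by
    refine (((((hasDerivAt_id x).const_mul ((starRingEnd ℂ) lam)).mul_const z).const_add
      1).const_mul (2 * (1 - (β : ℂ)))).congr_deriv ?_
    simp
  refine HasDerivAt.congr_of_eventuallyEq ?_ heq
  refine ((h2.div h1 hD).const_add (2 * (β : ℂ) - 1)).congr_deriv ?_
  rw [div_eq_iff (pow_ne_zero 2 hD)]
  field_simp
  rw [mobiusDenom]
  ring

theorem differentiableOn_extremalValue (β : ℝ) (hlam : ‖lam‖ < 1) (hz₀ : ‖z₀‖ < 1) {R : ℝ}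
    (hR : R * ‖z₀‖ < 1) : DifferentiableOn ℂ (extremalValue β lam z₀) (ball 0 R) := by
  intro x hx
  obtain ⟨r, hxr, hrR⟩ := exists_between (mem_ball_zero_iff.1 hx)
  have hmem : ∀ y : ℂ, ‖y‖ ≤ r → ∀ t ∈ Icc (0 : ℝ) 1, ‖(t : ℂ) * z₀‖ < 1 ∧ ‖y * (t * z₀)‖ < 1 := by
    intro y hy t ht
    have h1 : ‖(t : ℂ) * z₀‖ ≤ ‖z₀‖ := by
      rw [norm_mul, Complex.norm_real, Real.norm_of_nonneg ht.1]
      exact mul_le_of_le_one_left (norm_nonneg _) ht.2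
    refine ⟨h1.trans_lt hz₀, ?_⟩
    rw [norm_mul]
    calc ‖y‖ * ‖(t : ℂ) * z₀‖ ≤ R * ‖z₀‖ :=
          mul_le_mul (hy.trans hrR.le) h1 (norm_nonneg _) ((norm_nonneg y).trans (hy.trans hrR.le))
      _ < 1 := hR
  set F' : ℂ → ℝ → ℂ := fun y t => (t * z₀) ^ 2 * (2 * (1 - (β : ℂ)) *
    (1 - (starRingEnd ℂ) lam * lam) / mobiusDenom lam y (t * z₀) ^ 2) * z₀ with hF'
  have hcont' : ContinuousOn (fun q : ℂ × ℝ => F' q.1 q.2)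
      (closedBall 0 r ×ˢ Icc (0 : ℝ) 1) := by
    have hne : ∀ q ∈ closedBall (0 : ℂ) r ×ˢ Icc (0 : ℝ) 1,
        mobiusDenom lam q.1 (q.2 * z₀) ^ 2 ≠ 0 := fun q hq => by
      obtain ⟨h1, h2⟩ := hmem q.1 (mem_closedBall_zero_iff.1 hq.1) q.2 hq.2
      exact pow_ne_zero 2 (mobiusDenom_ne_zero hlam h1 h2)
    have hD : Continuous fun q : ℂ × ℝ => mobiusDenom lam q.1 (q.2 * z₀) ^ 2 := by
      unfold mobiusDenom; fun_prop
    refine ContinuousOn.mul (ContinuousOn.mul (by fun_prop) ?_) continuousOn_const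
    exact continuousOn_const.div hD.continuousOn hne
  obtain ⟨C, hC⟩ := ((isCompact_closedBall (0 : ℂ) r).prod isCompact_Icc).exists_bound_of_continuousOn
    hcont'
  have hFcont : ∀ y : ℂ, ‖y‖ ≤ r →
      ContinuousOn (fun t : ℝ => extremalP β lam y (t * z₀) * z₀) (Icc 0 1) := by
    intro y hy
    refine ContinuousOn.mul (ContinuousOn.congr (f := fun t : ℝ => (2 * (β : ℂ) - 1) +
      2 * (1 - (β : ℂ)) * (1 + (starRingEnd ℂ) lam * y * (t * z₀)) / mobiusDenom lam y (t * z₀))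
      ?_ fun t ht => ?_) continuousOn_const
    · have hD : Continuous fun t : ℝ => mobiusDenom lam y (t * z₀) := by
        unfold mobiusDenom; fun_prop
      exact continuousOn_const.add (ContinuousOn.div (by fun_prop) hD.continuousOn
        fun t ht => mobiusDenom_ne_zero hlam (hmem y hy t ht).1 (hmem y hy t ht).2)
    · exact extremalP_eq β hlam (hmem y hy t ht).1 (hmem y hy t ht).2
  have hsubset : uIoc (0 : ℝ) 1 ⊆ Icc 0 1 := by
    rw [uIoc_of_le zero_le_one]; exact Ioc_subset_Icc_self
  have hball : ball (0 : ℂ) r ∈ nhds x := isOpen_ball.mem_nhds (mem_ball_zero_iff.2 hxr)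
  have hF'cont : ContinuousOn (F' x) (Icc 0 1) :=
    hcont'.comp (f := fun t : ℝ => (x, t)) (by fun_prop)
      fun t ht => ⟨mem_closedBall_zero_iff.2 hxr.le, ht⟩
  have := intervalIntegral.hasDerivAt_integral_of_dominated_loc_of_deriv_le
    (μ := MeasureTheory.volume) (a := 0) (b := 1)
    (F := fun y t => extremalP β lam y (t * z₀) * z₀) (F' := F') (bound := fun _ => C) hball
    (Filter.eventually_of_mem hball fun y hy =>
      ((hFcont y (mem_ball_zero_iff.1 hy).le).mono hsubset).aestronglyMeasurable
        measurableSet_uIoc)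
    ((hFcont x hxr.le).intervalIntegrable_of_Icc zero_le_one)
    ((hF'cont.mono hsubset).aestronglyMeasurable measurableSet_uIoc)
    (Filter.Eventually.of_forall fun t ht y hy =>
      hC (y, t) ⟨ball_subset_closedBall hy, hsubset ht⟩)
    intervalIntegrable_const
    (Filter.Eventually.of_forall fun t ht y hy => by
      obtain ⟨h1, h2⟩ := hmem y (mem_ball_zero_iff.1 hy).le t (hsubset ht)
      exact (hasDerivAt_extremalP_param β hlam h1 h2).mul_const z₀)
  exact this.2.differentiableAt.differentiableWithinAt

/-! ### The closed form of the boundary curve -/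

theorem boundaryCurve_zero (β : ℝ) (lam : ℂ) (θ : ℝ) : boundaryCurve β lam 0 θ = 0 := by
  simp [boundaryCurve]

/-- With `u = e^{iθ/2} z`, the denominator factors as
`1 + 2 i b u - u² = (s - i b + u) (s + i b - u)`, where `s² + b² = 1`; the closed form is the
resulting partial fraction decomposition. -/
theorem hasDerivAt_boundaryCurve (β : ℝ) (hlam : ‖lam‖ < 1) (θ : ℝ) {z : ℂ} (hz : ‖z‖ < 1) :
    HasDerivAt (fun z => boundaryCurve β lam z θ)
      (extremalP β lam (Complex.exp (Complex.I * θ)) z) z := by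
  simp only [boundaryCurve]
  set e : ℂ := Complex.exp (Complex.I * θ / 2) with he
  set b : ℝ := ((starRingEnd ℂ) lam * e).im with hb
  set s : ℝ := Real.sqrt (1 - b ^ 2) with hs
  have he0 : e ≠ 0 := Complex.exp_ne_zero _
  have hen : ‖e‖ = 1 := by
    rw [he, mul_comm Complex.I, mul_div_right_comm, ← Complex.ofReal_ofNat, ← Complex.ofReal_div]
    exact Complex.norm_exp_ofReal_mul_I _
  have hee : e * (starRingEnd ℂ) e = 1 := by
    rw [Complex.mul_conj, Complex.normSq_eq_norm_sq, hen]; norm_num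
  have hea : Complex.exp (Complex.I * θ) = e ^ 2 := by
    rw [he, ← Complex.exp_nat_mul]; congr 1; push_cast; ring
  have hei : Complex.exp (-(Complex.I * θ / 2)) = e⁻¹ := Complex.exp_neg _
  have hb1 : b ^ 2 < 1 := by
    have h1 : |b| ≤ ‖(starRingEnd ℂ) lam * e‖ := Complex.abs_im_le_norm _
    rw [norm_mul, RCLike.norm_conj, hen, mul_one] at h1
    exact (sq_lt_one_iff_abs_lt_one b).2 (h1.trans_lt hlam)
  have hs0 : 0 < s := Real.sqrt_pos.2 (by linarith)
  have hs2 : (s : ℂ) ^ 2 = 1 - (b : ℂ) ^ 2 := by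
    have : s ^ 2 = 1 - b ^ 2 := Real.sq_sqrt (by linarith)
    exact_mod_cast this
  have hsC : (s : ℂ) ≠ 0 := by exact_mod_cast hs0.ne'
  have hp : ((s : ℂ) + Complex.I * b) * (s - Complex.I * b) = 1 := by
    linear_combination hs2 - (b : ℂ) ^ 2 * Complex.I_sq
  have hp0 : (s : ℂ) + Complex.I * b ≠ 0 := left_ne_zero_of_mul_eq_one hp
  have hm0 : (s : ℂ) - Complex.I * b ≠ 0 := right_ne_zero_of_mul_eq_one hp
  have hconj : (starRingEnd ℂ) ((s : ℂ) + Complex.I * b) = s - Complex.I * b := by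
    simp [sub_eq_add_neg]
  have hpn : ‖(s : ℂ) + Complex.I * b‖ = 1 := by
    rw [← hconj, Complex.mul_conj, Complex.normSq_eq_norm_sq] at hp
    have h1 : ‖(s : ℂ) + Complex.I * b‖ ^ 2 = 1 := by exact_mod_cast hp
    exact (pow_eq_one_iff_of_nonneg (norm_nonneg _) two_ne_zero).1 h1
  have hmn : ‖(s : ℂ) - Complex.I * b‖ = 1 := by rw [← hconj, RCLike.norm_conj, hpn]
  have hun : ‖e * z‖ < 1 := by rwa [norm_mul, hen, one_mul]
  have hl1 : 1 + e * z / (s - Complex.I * b) ∈ Complex.slitPlane :=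
    Complex.mem_slitPlane_of_norm_lt_one (by rwa [norm_div, hmn, div_one])
  have hl2 : 1 - e * z / (s + Complex.I * b) ∈ Complex.slitPlane := by
    rw [sub_eq_add_neg]
    exact Complex.mem_slitPlane_of_norm_lt_one (by rwa [norm_neg, norm_div, hpn, div_one])
  have hd1 : HasDerivAt (fun z : ℂ => Complex.log (1 + e * z / (s - Complex.I * b)))
      (e / (s - Complex.I * b) / (1 + e * z / (s - Complex.I * b))) z := by
    refine HasDerivAt.clog ?_ hl1
    simpa using (((hasDerivAt_id z).const_mul e).div_const ((s : ℂ) - Complex.I * b)).const_add 1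
  have hd2 : HasDerivAt (fun z : ℂ => Complex.log (1 - e * z / (s + Complex.I * b)))
      (-(e / (s + Complex.I * b)) / (1 - e * z / (s + Complex.I * b))) z := by
    refine HasDerivAt.clog ?_ hl2
    simpa using (((hasDerivAt_id z).const_mul e).div_const ((s : ℂ) + Complex.I * b)).const_sub 1
  have hd := ((hasDerivAt_id z).const_mul (2 * (β : ℂ) - 1)).add
    (((hd1.const_mul (1 + (starRingEnd ℂ) lam * e * (-(s : ℂ) + Complex.I * b))).sub
      (hd2.const_mul (1 + (starRingEnd ℂ) lam * e * (s + Complex.I * b)))).const_mul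
      ((1 - (β : ℂ)) * Complex.exp (-(Complex.I * θ / 2)) / s))
  refine hd.congr_deriv ?_
  have hxz : ‖e ^ 2 * z‖ < 1 := by rwa [norm_mul, norm_pow, hen, one_pow, one_mul]
  have h2ib : (starRingEnd ℂ) lam * e - lam * (starRingEnd ℂ) e = 2 * Complex.I * b := by
    have h1 := Complex.sub_conj ((starRingEnd ℂ) lam * e)
    rw [map_mul, Complex.conj_conj, ← hb] at h1
    rw [h1]; push_cast; ring
  have hDf : mobiusDenom lam (e ^ 2) z =
      (s - Complex.I * b + e * z) * (s + Complex.I * b - e * z) := by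
    rw [mobiusDenom]
    linear_combination e * z * h2ib + lam * z * hee - hp
  have hD0 := mobiusDenom_ne_zero hlam hz hxz
  rw [hDf] at hD0
  have hq1 := left_ne_zero_of_mul hD0
  have hq2 := right_ne_zero_of_mul hD0
  have e1 : e / (s - Complex.I * b) / (1 + e * z / (s - Complex.I * b)) =
      e / (s - Complex.I * b + e * z) := by
    rw [div_div]; congr 1; field_simp
  have e2 : -(e / (s + Complex.I * b)) / (1 - e * z / (s + Complex.I * b)) =
      -(e / (s + Complex.I * b - e * z)) := by
    rw [neg_div, div_div]; congr 2; field_simp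
  rw [hea, extremalP_eq β hlam hz hxz, e1, e2, hei, hDf]
  generalize (starRingEnd ℂ) lam = l
  field_simp
  ring

theorem extremalValue_eq_boundaryCurve (β : ℝ) (hlam : ‖lam‖ < 1) (hz₀ : ‖z₀‖ < 1) (θ : ℝ) :
    extremalValue β lam z₀ (Complex.exp (Complex.I * θ)) = boundaryCurve β lam z₀ θ := by
  have ha : ‖Complex.exp (Complex.I * θ)‖ ≤ 1 := by
    rw [mul_comm]; exact (Complex.norm_exp_ofReal_mul_I θ).le
  rw [extremalValue, integral_segment_deriv (differentiableOn_extremalP β hlam ha).continuousOn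
    (G := fun z => boundaryCurve β lam z θ)
    (fun z hz => hasDerivAt_boundaryCurve β hlam θ (mem_ball_zero_iff.1 hz))
    (mem_ball_zero_iff.2 hz₀), boundaryCurve_zero, sub_zero]

end ExtremalValue

/-! ### The region of variability -/

section Region

variable {α : ℂ} {β : ℝ} {lam z₀ : ℂ}

theorem differentiableOn_closedBall_extremalValue (β : ℝ) (hlam : ‖lam‖ < 1) (hz₀ : ‖z₀‖ < 1) :
    DifferentiableOn ℂ (extremalValue β lam z₀) (closedBall 0 1) := by
  obtain ⟨r, hr1, hr2⟩ := exists_between hz₀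
  have hr0 : 0 < r := (norm_nonneg _).trans_lt hr1
  refine (differentiableOn_extremalValue β hlam hz₀ (R := r⁻¹) ?_).mono
    (closedBall_subset_ball ((one_lt_inv₀ hr0).2 hr2))
  rwa [inv_mul_lt_iff₀ hr0, mul_one]

theorem valueG_eq_extremalValue {f : ℂ → ℂ} {a : ℂ} (hf : NormalizedAnalytic f)
    (hp : EqOn (derivValueG α f) (extremalP β lam a) (ball 0 1)) (hz₀ : ‖z₀‖ < 1) :
    valueG α z₀ f = extremalValue β lam z₀ a :=
  valueG_eq_integral hf hp (mem_ball_zero_iff.2 hz₀)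

theorem extremalValue_mem_regionG (hα : 0 < α.re) (hβ : β < 1) (hlam : ‖lam‖ < 1)
    (hz₀ : ‖z₀‖ < 1) {a : ℂ} (ha : ‖a‖ ≤ 1) : extremalValue β lam z₀ a ∈ regionG α β z₀ lam := by
  obtain ⟨f, hf, hp⟩ := exists_derivValueG_eq_extremalP hα β hlam ha
  exact ⟨f, mem_classG_of_derivValueG_eq hα hβ hlam hf ha hp, valueG_eq_extremalValue hf hp hz₀⟩

theorem extremalP_param_injective (hβ : β < 1) (hlam : ‖lam‖ < 1) {x y : ℂ} (hx : ‖x‖ ≤ 1)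
    (hy : ‖y‖ ≤ 1) (h : EqOn (extremalP β lam x) (extremalP β lam y) (ball 0 1)) : x = y := by
  have hz : ‖(2⁻¹ : ℂ)‖ < 1 := by norm_num
  have hxz := norm_mul_lt_one_of_le hx hz
  have hyz := norm_mul_lt_one_of_le hy hz
  have h1 := extremalP_sub_extremalP β hlam hz hxz hyz
  rw [h (mem_ball_zero_iff.2 hz), sub_self] at h1
  have hβ1 : (1 - (β : ℂ)) ≠ 0 := by
    rw [sub_ne_zero]; exact_mod_cast hβ.ne'
  have hl : 1 - (starRingEnd ℂ) lam * lam ≠ 0 := by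
    refine one_sub_ne_zero_of_norm_lt ?_
    rw [norm_mul, RCLike.norm_conj]
    nlinarith [norm_nonneg lam]
  simpa [hβ1, hl, mobiusDenom_ne_zero hlam hz hxz, mobiusDenom_ne_zero hlam hz hyz,
    sub_eq_zero] using h1.symm

theorem injOn_extremalValue (hα : 0 < α.re) (hβ : β < 1) (hlam : ‖lam‖ < 1) (hz₀ : ‖z₀‖ < 1)
    (hz₀' : z₀ ≠ 0) : InjOn (extremalValue β lam z₀) (sphere 0 1) := by
  intro x hx y hy hxy
  rw [mem_sphere_zero_iff_norm] at hx hy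
  obtain ⟨f, hf, hfp⟩ := exists_derivValueG_eq_extremalP hα β hlam hx.le
  obtain ⟨g, hg, hgp⟩ := exists_derivValueG_eq_extremalP hα β hlam hy.le
  obtain ⟨n, -, hn⟩ := exists_supporting_direction hα hβ hlam hy hz₀ hz₀'
  have heq : valueG α z₀ f = valueG α z₀ g := by
    rw [valueG_eq_extremalValue hf hfp hz₀, valueG_eq_extremalValue hg hgp hz₀, hxy]
  have h1 := (hn f (mem_classG_of_derivValueG_eq hα hβ hlam hf hx.le hfp) g hg hgp).2 heq
  exact extremalP_param_injective hβ hlam hx.le hy.le (hfp.symm.trans (h1.trans hgp))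

theorem frontier_regionG (hα : 0 < α.re) (hβ : β < 1) (hlam : ‖lam‖ < 1) (hz₀ : ‖z₀‖ < 1)
    (hz₀' : z₀ ≠ 0) :
    frontier (regionG α β z₀ lam) = extremalValue β lam z₀ '' sphere 0 1 := by
  have hd := differentiableOn_closedBall_extremalValue β hlam hz₀
  have hc : ContinuousOn (extremalValue β lam z₀) (closedBall 0 1) := hd.continuousOn
  refine frontier_eq_image_sphere (convex_regionG α hβ hz₀ lam) hc
    (hd.mono ball_subset_closedBall) ?_ ?_ ?_
  · rintro ⟨w, hw⟩
    have hconst : EqOn (extremalValue β lam z₀) (fun _ => w) (closedBall 0 1) :=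
      EqOn.of_subset_closure (s := ball 0 1) hw hc continuousOn_const ball_subset_closedBall
        (closure_ball (0 : ℂ) one_ne_zero).ge
    have h1 : (1 : ℂ) ∈ sphere (0 : ℂ) 1 := by simp
    have h2 : (-1 : ℂ) ∈ sphere (0 : ℂ) 1 := by simp
    have := injOn_extremalValue hα hβ hlam hz₀ hz₀' h1 h2
      ((hconst (sphere_subset_closedBall h1)).trans (hconst (sphere_subset_closedBall h2)).symm)
    norm_num at this
  · intro a ha
    exact extremalValue_mem_regionG hα hβ hlam hz₀ (mem_closedBall_zero_iff.1 ha)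
  · intro a ha
    rw [mem_sphere_zero_iff_norm] at ha
    obtain ⟨n, hn0, hn⟩ := exists_supporting_direction hα hβ hlam ha hz₀ hz₀'
    obtain ⟨g, hg, hgp⟩ := exists_derivValueG_eq_extremalP hα β hlam ha.le
    refine mem_frontier_of_re_le (extremalValue_mem_regionG hα hβ hlam hz₀ ha.le) hn0 ?_
    rintro _ ⟨f, hf, rfl⟩
    rw [← valueG_eq_extremalValue hg hgp hz₀]
    exact (hn f hf g hg hgp).1

end Region

theorem corollary6p3 (α : ℂ) (hα : 0 < α.re) (β : ℝ) (hβ : β < 1)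
    (lam : ℂ) (hlam : ‖lam‖ < 1) (z₀ : ℂ) (hz₀ : ‖z₀‖ < 1) (hz₀' : z₀ ≠ 0) :
    -- the extremal functions exist, are unique in the disk, and belong to the class
    (∀ θ : ℝ, ∃ F ∈ ClassG α β lam,
      IsExtremalFunction α β lam (Complex.exp (Complex.I * θ)) F ∧
      ∀ g, IsExtremalFunction α β lam (Complex.exp (Complex.I * θ)) g →
        Set.EqOn g F (Metric.ball 0 1)) ∧
    -- the statement about the extremal functions
    ∀ F : ℝ → ℂ → ℂ,
      (∀ θ : ℝ, IsExtremalFunction α β lam (Complex.exp (Complex.I * θ)) (F θ)) →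
      (∀ θ ∈ Set.Ioc (-Real.pi) Real.pi, valueG α z₀ (F θ) = boundaryCurve β lam z₀ θ) ∧
      IsJordanParametrization (fun θ => valueG α z₀ (F θ)) ∧
      frontier (regionG α β z₀ lam) =
        (fun θ => valueG α z₀ (F θ)) '' Set.Ioc (-Real.pi) Real.pi ∧
      ∀ f ∈ ClassG α β lam, ∀ θ ∈ Set.Ioc (-Real.pi) Real.pi,
        valueG α z₀ f = valueG α z₀ (F θ) → Set.EqOn f (F θ) (Metric.ball 0 1) := by
  have hnorm : ∀ θ : ℝ, ‖Complex.exp (Complex.I * θ)‖ = 1 := fun θ => by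
    rw [mul_comm]; exact Complex.norm_exp_ofReal_mul_I θ
  have hsph : ∀ θ : ℝ, Complex.exp (Complex.I * θ) ∈ sphere (0 : ℂ) 1 := fun θ =>
    mem_sphere_zero_iff_norm.2 (hnorm θ)
  refine ⟨fun θ => ?_, fun F hF => ?_⟩
  · obtain ⟨f, hf, hp⟩ := exists_derivValueG_eq_extremalP hα β hlam (hnorm θ).le
    refine ⟨f, mem_classG_of_derivValueG_eq hα hβ hlam hf (hnorm θ).le hp,
      (isExtremalFunction_iff hα hlam (hnorm θ).le).2 ⟨hf, hp⟩, fun g hg => ?_⟩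
    obtain ⟨hg, hgp⟩ := (isExtremalFunction_iff hα hlam (hnorm θ).le).1 hg
    exact eqOn_of_derivValueG_eqOn hα hg hf (hgp.trans hp.symm)
  have hF' := fun θ => (isExtremalFunction_iff hα hlam (hnorm θ).le).1 (hF θ)
  have hval : ∀ θ : ℝ, valueG α z₀ (F θ) =
      extremalValue β lam z₀ (Complex.exp (Complex.I * θ)) := fun θ =>
    valueG_eq_extremalValue (hF' θ).1 (hF' θ).2 hz₀
  refine ⟨fun θ _ => (hval θ).trans (extremalValue_eq_boundaryCurve β hlam hz₀ θ), ?_, ?_, ?_⟩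
  · simp only [hval]
    refine ⟨?_, ?_, ?_⟩
    · exact (differentiableOn_closedBall_extremalValue β hlam hz₀).continuousOn.comp
        (by fun_prop) fun θ _ => sphere_subset_closedBall (hsph θ)
    · refine congrArg (extremalValue β lam z₀) ?_
      rw [mul_comm, mul_comm Complex.I]
      simp [Complex.exp_neg]
    · intro θ hθ η hη h
      have h1 := injOn_extremalValue hα hβ hlam hz₀ hz₀' (hsph θ) (hsph η) h
      have h2 := Complex.exp_inj_of_neg_pi_lt_of_le_pi (by simpa using hθ.1) (by simpa using hθ.2)
        (by simpa using hη.1) (by simpa using hη.2) h1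
      simpa using h2
  · rw [frontier_regionG hα hβ hlam hz₀ hz₀']
    simp only [hval]
    ext w
    constructor
    · rintro ⟨a, ha, rfl⟩
      refine ⟨a.arg, Complex.arg_mem_Ioc a, ?_⟩
      have := Complex.norm_mul_exp_arg_mul_I a
      rw [mem_sphere_zero_iff_norm.1 ha, Complex.ofReal_one, one_mul, mul_comm] at this
      simp only [this]
    · rintro ⟨θ, -, rfl⟩
      exact ⟨_, hsph θ, rfl⟩
  · intro f hf θ _ h
    obtain ⟨n, -, hn⟩ := exists_supporting_direction hα hβ hlam (hnorm θ) hz₀ hz₀'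
    exact eqOn_of_derivValueG_eqOn hα hf.1.1 (hF' θ).1 ((hn f hf _ (hF' θ).1 (hF' θ).2).2 h)
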